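/- Let $\Phi=[\phi_{\min},\phi_{\max}]$ with $\phi_{\min}<\phi_{\max}$, let $(\rho_\theta)_{\theta\in\Phi}$ be density operators on a complex Hilbert space, and let $\Pi$ be a positive operator-valued measure on $\mathbb{R}$ whose outcomes lie in $[a,b]$. Measuring $\Pi$ in the state $\rho_\theta$ gives an outcome with distribution $P_\theta(B)=\operatorname{Tr}[\rho_\theta\Pi(B)]$; let $f(\theta)=\int x\,dP_\theta(x)$ be its expectation. Assume that $f$ is injective and twice differentiable on $\Phi$ (one-sided at the end points), that $f'(\theta)\neq0$ for all $\theta\in\Phi$, and that the maximum $$L:=\max_{\theta\in\Phi}\left|f'(\theta)^{-3}f''(\theta)\right|$$ exists. For data $x^n=(x_1,\dots,x_n)$ put $S_n=\frac1n\sum_{i=1}^n x_i$, $V_{\max}=(b-a)^2/4$, and, for $n\ge2$, $V_n=\frac1{n-1}\sum_{i=1}^n(x_i-S_n)^2$. Let $\phi^{\mathrm{LS}}_n=\phi^{\mathrm{LS}}_n(x^n)$ be the (unique) minimizer of $|S_n-f(\theta)|$ over $\theta\in\Phi$. For $\epsilon\in(0,1)$ define $$\delta_1(x^n,\epsilon)=\frac{1}{|f'(\phi^{\mathrm{LS}}_n)|}\sqrt{\frac2n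 V_{\max}\ln\frac2\epsilon}+\frac Ln V_{\max}\ln\frac2\epsilon$$ and, for $n\ge2$, $$R=\sqrt{\frac2n V_n\ln\frac4\epsilon}+\frac{8(b-a)}{3(n-1)}\ln\frac4\epsilon,\qquad \delta_2(x^n,\epsilon)=\frac{1}{|f'(\phi^{\mathrm{LS}}_n)|}R+\frac L2R^2 .$$ Let $\delta(x^n,\epsilon)=\delta_1(x^n,\epsilon)$ if $n=1$ and $\delta(x^n,\epsilon)=\min\{\delta_1(x^n,\epsilon),\delta_2(x^n,\epsilon)\}$ if $n\ge2$. Then for every $n\ge1$, every $\epsilon\in(0,1)$ and every true parameter $\phi\in\Phi$, if $x_1,\dots,x_n$ are independent with distribution $P_\phi$, then $$|\phi^{\mathrm{LS}}_n(x^n)-\phi|\le\delta(x^n,\epsilon)$$ holds with probability at least $1-\epsilon$. -/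

import Mathlib

open MeasureTheory ProbabilityTheory Set

noncomputable section

namespace Metrology

section Quantum

variable {H : Type*} [NormedAddCommGroup H] [InnerProductSpace ℂ H] [CompleteSpace H]

/-- The trace `∑ᵢ ⟨eᵢ, A eᵢ⟩` of an operator on a complex Hilbert space, computed in some fixed
orthonormal (Hilbert) basis; for trace class operators the value does not depend on the basis. -/
def opTrace (A : H →L[ℂ] H) : ℂ :=
  ∑' i, inner ℂ ((exists_hilbertBasis ℂ H).choose_spec.choose i)
    (A ((exists_hilbertBasis ℂ H).choose_spec.choose i))

/-- Density operators (quantum states): positive operators of trace one. (A positive operator whose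
diagonal is not summable has `opTrace` equal to `0`, so it is not a density operator.) -/
def IsDensityOperator (ρ : H →L[ℂ] H) : Prop :=
  ρ.IsPositive ∧ opTrace ρ = 1

variable (H) in
/-- A positive operator-valued measure with real outcomes: `effect B` is the operator of the event
that the outcome lies in the Borel set `B`. A discrete family `(Π_x)` is the case
`effect B = ∑ x ∈ B, Π_x`. -/
structure POVM where
  effect : Set ℝ → H →L[ℂ] H
  isPositive : ∀ B, MeasurableSet B → (effect B).IsPositive
  effect_univ : effect univ = 1
  hasSum_effect : ∀ B : ℕ → Set ℝ, (∀ k, MeasurableSet (B k)) →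
    Pairwise (fun j k => Disjoint (B j) (B k)) →
    ∀ u : H, HasSum (fun k => effect (B k) u) (effect (⋃ k, B k) u)

/-- Born's rule: `P` is the distribution of the outcome when `M` is measured in the state `ρ`,
that is, `P(B) = Tr[ρ M(B)]` for every Borel set `B`. -/
def IsOutcomeLaw (ρ : H →L[ℂ] H) (M : POVM H) (P : Measure ℝ) : Prop :=
  ∀ B, MeasurableSet B → P B = ENNReal.ofReal (opTrace (ρ * M.effect B)).re

end Quantum

/-- The sample mean `S_n`. -/
def sampleMean {n : ℕ} (x : Fin n → ℝ) : ℝ := (1 / (n : ℝ)) * ∑ i, x i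

/-- The unbiased sample variance `V_n` (used for `n ≥ 2` only). -/
def sampleVar {n : ℕ} (x : Fin n → ℝ) : ℝ :=
  (1 / ((n : ℝ) - 1)) * ∑ i, (x i - sampleMean x) ^ 2

/-- `V_max = (b - a)² / 4`. -/
def Vmax (a b : ℝ) : ℝ := (b - a) ^ 2 / 4

/-- `t` minimizes `|S_n - f t'|` over `t' ∈ Φ`. -/
def IsLeastSquares (f : ℝ → ℝ) (Φ : Set ℝ) {n : ℕ} (x : Fin n → ℝ) (t : ℝ) : Prop :=
  t ∈ Φ ∧ ∀ t' ∈ Φ, |sampleMean x - f t| ≤ |sampleMean x - f t'|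

/-- The least squares estimate, the minimizer of `|S_n - f t'|` over `t' ∈ Φ`. -/
def lsEstimate (f : ℝ → ℝ) (Φ : Set ℝ) {n : ℕ} (x : Fin n → ℝ) : ℝ :=
  Classical.epsilon (IsLeastSquares f Φ x)

/-- The minimizer exists and is unique when `f` is continuous and injective on an interval. -/
theorem existsUnique_isLeastSquares {f : ℝ → ℝ} {c d : ℝ} (hcd : c ≤ d)
    (hf : ContinuousOn f (Icc c d)) (hinj : InjOn f (Icc c d)) {n : ℕ} (x : Fin n → ℝ) :
    ∃! t, IsLeastSquares f (Icc c d) x t := by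
  have hc : ContinuousOn (fun t => |sampleMean x - f t|) (Icc c d) :=
    (continuousOn_const.sub hf).abs
  obtain ⟨t, ht, hmin⟩ := isCompact_Icc.exists_isMinOn (nonempty_Icc.2 hcd) hc
  have htm : ∀ t' ∈ Icc c d, |sampleMean x - f t| ≤ |sampleMean x - f t'| :=
    fun t' ht' => hmin ht'
  refine ⟨t, ⟨ht, htm⟩, ?_⟩
  rintro u ⟨hu, hum⟩
  apply hinj hu ht
  have heq : |sampleMean x - f u| = |sampleMean x - f t| :=
    le_antisymm (hum t ht) (htm u hu)
  rcases abs_eq_abs.1 heq with h | h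
  · linarith
  · have hconn : (f '' Icc c d).OrdConnected := (isPreconnected_Icc.image f hf).ordConnected
    have hmem : sampleMean x ∈ f '' Icc c d := by
      have hs : sampleMean x = (f u + f t) / 2 := by linarith
      rcases le_total (f u) (f t) with hle | hle
      · exact hconn.out (mem_image_of_mem f hu) (mem_image_of_mem f ht)
          ⟨by linarith, by linarith⟩
      · exact hconn.out (mem_image_of_mem f ht) (mem_image_of_mem f hu)
          ⟨by linarith, by linarith⟩
    obtain ⟨w, hw, hfw⟩ := hmem
    have h1 := hum w hw
    have h2 := htm w hw
    rw [hfw, sub_self, abs_zero] at h1 h2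
    have h3 := abs_eq_zero.1 (le_antisymm h1 (abs_nonneg _))
    have h4 := abs_eq_zero.1 (le_antisymm h2 (abs_nonneg _))
    linarith

/-- Hence `lsEstimate` is this minimizer. -/
theorem isLeastSquares_lsEstimate {f : ℝ → ℝ} {c d : ℝ} (hcd : c ≤ d)
    (hf : ContinuousOn f (Icc c d)) (hinj : InjOn f (Icc c d)) {n : ℕ} (x : Fin n → ℝ) :
    IsLeastSquares f (Icc c d) x (lsEstimate f (Icc c d) x) :=
  Classical.epsilon_spec (existsUnique_isLeastSquares hcd hf hinj x).exists

/-- The set of the values `|f'(t)⁻³ f''(t)|`, `t ∈ Φ`, with derivatives relative to `Φ`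
(one-sided at the end points of an interval). Its maximum is the curvature constant `L`. -/
def curvatureValues (f : ℝ → ℝ) (Φ : Set ℝ) : Set ℝ :=
  (fun t => |(derivWithin f Φ t ^ 3)⁻¹ * derivWithin (derivWithin f Φ) Φ t|) '' Φ

/-- The Hoeffding type bound `δ₁`. -/
def delta1 (f : ℝ → ℝ) (Φ : Set ℝ) (a b L : ℝ) {n : ℕ} (x : Fin n → ℝ) (ε : ℝ) : ℝ :=
  1 / |derivWithin f Φ (lsEstimate f Φ x)| * Real.sqrt (2 / n * Vmax a b * Real.log (2 / ε))
    + L / n * Vmax a b * Real.log (2 / ε)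

/-- The radius `√(2 V_n ln(4/ε) / n) + 8 (b - a) ln(4/ε) / (3 (n - 1))`. -/
def bernsteinRadius (a b : ℝ) {n : ℕ} (x : Fin n → ℝ) (ε : ℝ) : ℝ :=
  Real.sqrt (2 / n * sampleVar x * Real.log (4 / ε))
    + 8 * (b - a) / (3 * ((n : ℝ) - 1)) * Real.log (4 / ε)

/-- The empirical Bernstein type bound `δ₂`. -/
def delta2 (f : ℝ → ℝ) (Φ : Set ℝ) (a b L : ℝ) {n : ℕ} (x : Fin n → ℝ) (ε : ℝ) : ℝ :=
  1 / |derivWithin f Φ (lsEstimate f Φ x)| * bernsteinRadius a b x ε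
    + L / 2 * bernsteinRadius a b x ε ^ 2

/-- The error bar `δ`: `δ₁` if `n = 1`, and `min δ₁ δ₂` if `n ≥ 2`. -/
def delta (f : ℝ → ℝ) (Φ : Set ℝ) (a b L : ℝ) {n : ℕ} (x : Fin n → ℝ) (ε : ℝ) : ℝ :=
  if n = 1 then delta1 f Φ a b L x ε
  else min (delta1 f Φ a b L x ε) (delta2 f Φ a b L x ε)

end Metrology

end

/-! The deterministic half: `lsEstimate` is the point of `Φ` whose value under `f` is the projection
of `S_n` onto the interval `f(Φ)`, so `|f φ - f s| ≤ |S_n - f φ|` for the estimate `s`. The inverse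
function `g` of `f` has `g' = 1/f'` and `g'' = -f''/f'^3`, hence `|g''| ≤ L`. Taylor's formula for
`g` at `f s` turns any bound `r` on `|S_n - f φ|` into the error bar `r / |f' s| + L r²/2`
(`abs_sub_le_of_mem_curvatureValues_le`).

The probabilistic half: with total failure probability `ε`, the Hoeffding radius and the empirical
Bernstein radius must both hold. Each alone is standard, but a union bound over the two would exceed
`ε`. Put `l = log (2/ε)` and `t = log (4/ε)`. Outside an event of probability at most `exp (-4t/3)`,
the sample standard deviation is so large that the empirical Bernstein radius exceeds the Bernstein
radius with the true variance (`measure_sqrt_sampleVar_lt`, `sqrt_mul_sqrt_le_sub`). What remains is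
the minimum of two deterministic radii, so only the smaller one needs a tail bound. If it is
Bernstein's, its probability `2 exp (-t) = ε/2` leaves ample room. If it is Hoeffding's, its usual
bound `2 exp (-l) = ε` leaves none, and a sharpened inequality supplies the missing `exp (-4t/3)`
(`measure_abs_sum_gt_add_exp_le`). The sharpening applies Markov's inequality to `Z² cosh (uZ)`
instead of to an exponential. -/

namespace Metrology

/-! ### Second order expansion of the inverse of `f`, and the least squares projection -/

section Inverse

variable {f f' f'' : ℝ → ℝ} {c d L : ℝ}

/-- The slope `1 / f'` varies at most `L` times as fast as `f`. -/
theorem abs_inv_sub_inv_le_of_curvature_le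
    (hf : ∀ θ ∈ Icc c d, HasDerivWithinAt f (f' θ) (Icc c d) θ)
    (hf' : ∀ θ ∈ Icc c d, HasDerivWithinAt f' (f'' θ) (Icc c d) θ)
    (hpos : ∀ θ ∈ Icc c d, 0 < f' θ) (hL : ∀ θ ∈ Icc c d, |f'' θ| ≤ L * f' θ ^ 3)
    {s t : ℝ} (hs : s ∈ Icc c d) (ht : t ∈ Icc c d) (hst : s ≤ t) :
    |(f' t)⁻¹ - (f' s)⁻¹| ≤ L * (f t - f s) := by
  -- The derivative of `1/f'` is `-f''/f'^2`, at most `L f'` in absolute value; the signs `σ = ±1`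
  -- give the two sides of the estimate.
  have key : ∀ σ : ℝ, |σ| = 1 → MonotoneOn (fun θ => L * f θ + σ * (f' θ)⁻¹) (Icc c d) := by
    intro σ hσ
    have hder : ∀ θ ∈ Icc c d, HasDerivWithinAt (fun θ => L * f θ + σ * (f' θ)⁻¹)
        (L * f' θ + σ * (-f'' θ / f' θ ^ 2)) (Icc c d) θ := fun θ hθ =>
      ((hf θ hθ).const_mul L).add (((hf' θ hθ).inv (hpos θ hθ).ne').const_mul σ)
    refine monotoneOn_of_hasDerivWithinAt_nonneg (convex_Icc c d)
      (fun θ hθ => (hder θ hθ).continuousWithinAt)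
      (fun θ hθ => (hder θ (interior_subset hθ)).mono interior_subset) fun θ hθ => ?_
    have hθ := interior_subset hθ
    have hp := hpos θ hθ
    have h1 : |σ * (-f'' θ / f' θ ^ 2)| ≤ L * f' θ := by
      rw [abs_mul, hσ, one_mul, abs_div, abs_neg, abs_of_pos (pow_pos hp 2),
        div_le_iff₀ (pow_pos hp 2)]
      calc _ ≤ _ := hL θ hθ
        _ = _ := by ring
    linarith [neg_le_of_abs_le h1]
  have h1 := key 1 (by simp) hs ht hst
  have h2 := key (-1) (by simp) hs ht hst
  simp only at h1 h2
  rw [abs_le]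
  constructor <;> linarith

/-- Second order expansion of the inverse of a function with positive derivative. -/
theorem abs_sub_le_of_curvature_le
    (hf : ∀ θ ∈ Icc c d, HasDerivWithinAt f (f' θ) (Icc c d) θ)
    (hf' : ∀ θ ∈ Icc c d, HasDerivWithinAt f' (f'' θ) (Icc c d) θ)
    (hpos : ∀ θ ∈ Icc c d, 0 < f' θ) (hL : ∀ θ ∈ Icc c d, |f'' θ| ≤ L * f' θ ^ 3)
    {s t : ℝ} (hs : s ∈ Icc c d) (ht : t ∈ Icc c d) :
    |t - s| ≤ 1 / f' s * |f t - f s| + L / 2 * (f t - f s) ^ 2 := by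
  have hder : ∀ σ : ℝ, ∀ θ ∈ Icc c d,
      HasDerivWithinAt (fun θ => L / 2 * (f θ - f s) ^ 2 + σ * (θ - f θ * (f' s)⁻¹))
        (f' θ * (L * (f θ - f s) + σ * ((f' θ)⁻¹ - (f' s)⁻¹))) (Icc c d) θ := by
    intro σ θ hθ
    have h := (((((hf θ hθ).sub_const (f s)).pow 2).const_mul (L / 2))).add
      (((hasDerivWithinAt_id θ (Icc c d)).sub ((hf θ hθ).mul_const (f' s)⁻¹)).const_mul σ)
    refine h.congr_deriv ?_
    have := (hpos θ hθ).ne'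
    push_cast
    field_simp
  -- The function in `hder` decreases to the left of `s` and increases to the right, so it is
  -- smallest at `s`; `σ = ±1` again gives both sides of the Taylor remainder.
  have key : ∀ σ : ℝ, |σ| = 1 →
      σ * (s - f s * (f' s)⁻¹) ≤ L / 2 * (f t - f s) ^ 2 + σ * (t - f t * (f' s)⁻¹) := by
    intro σ hσ
    rcases le_total s t with hst | hst
    · have hsub : Icc s t ⊆ Icc c d := Icc_subset_Icc hs.1 ht.2
      have hm := monotoneOn_of_hasDerivWithinAt_nonneg (convex_Icc s t)
        (fun θ hθ => ((hder σ θ (hsub hθ)).mono hsub).continuousWithinAt)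
        (fun θ hθ => (hder σ θ (hsub (interior_subset hθ))).mono (interior_subset.trans hsub))
        (fun θ hθ => by
          have hθ' := interior_subset hθ
          have h1 := abs_inv_sub_inv_le_of_curvature_le hf hf' hpos hL hs (hsub hθ') hθ'.1
          have h2 : |σ * ((f' θ)⁻¹ - (f' s)⁻¹)| ≤ L * (f θ - f s) := by
            rw [abs_mul, hσ, one_mul]; exact h1
          exact mul_nonneg (hpos θ (hsub hθ')).le (by linarith [neg_le_of_abs_le h2]))
      have := hm (left_mem_Icc.2 hst) (right_mem_Icc.2 hst) hst
      simpa using this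
    · have hsub : Icc t s ⊆ Icc c d := Icc_subset_Icc ht.1 hs.2
      have hm := antitoneOn_of_hasDerivWithinAt_nonpos (convex_Icc t s)
        (fun θ hθ => ((hder σ θ (hsub hθ)).mono hsub).continuousWithinAt)
        (fun θ hθ => (hder σ θ (hsub (interior_subset hθ))).mono (interior_subset.trans hsub))
        (fun θ hθ => by
          have hθ' := interior_subset hθ
          have h1 := abs_inv_sub_inv_le_of_curvature_le hf hf' hpos hL (hsub hθ') hs hθ'.2
          have h2 : |σ * ((f' θ)⁻¹ - (f' s)⁻¹)| ≤ L * (f s - f θ) := by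
            rw [abs_mul, hσ, one_mul, abs_sub_comm]; exact h1
          exact mul_nonpos_of_nonneg_of_nonpos (hpos θ (hsub hθ')).le
            (by linarith [le_of_abs_le h2]))
      have := hm (left_mem_Icc.2 hst) (right_mem_Icc.2 hst) hst
      simpa using this
  have h1 := key 1 (by simp)
  have h2 := key (-1) (by simp)
  have h3 : |t - s - (f t - f s) * (f' s)⁻¹| ≤ L / 2 * (f t - f s) ^ 2 := by
    rw [abs_le]; constructor <;> linarith
  have h4 : |(f t - f s) * (f' s)⁻¹| = 1 / f' s * |f t - f s| := by
    rw [abs_mul, abs_of_pos (inv_pos.2 (hpos s hs))]; ring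
  calc |t - s| = |(f t - f s) * (f' s)⁻¹ + (t - s - (f t - f s) * (f' s)⁻¹)| := by ring_nf
    _ ≤ _ := abs_add_le _ _
    _ ≤ _ := by rw [h4]; gcongr

/-- The same for a derivative without zeros. -/
theorem abs_sub_le_of_mem_curvatureValues_le (hd1 : DifferentiableOn ℝ f (Icc c d))
    (hd2 : DifferentiableOn ℝ (derivWithin f (Icc c d)) (Icc c d))
    (hne : ∀ θ ∈ Icc c d, derivWithin f (Icc c d) θ ≠ 0)
    (hL : ∀ y ∈ curvatureValues f (Icc c d), y ≤ L)
    {s t : ℝ} (hs : s ∈ Icc c d) (ht : t ∈ Icc c d) :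
    |t - s| ≤ 1 / |derivWithin f (Icc c d) s| * |f t - f s| + L / 2 * (f t - f s) ^ 2 := by
  set f₁ := derivWithin f (Icc c d)
  set f₂ := derivWithin f₁ (Icc c d)
  have h1 : ∀ θ ∈ Icc c d, HasDerivWithinAt f (f₁ θ) (Icc c d) θ :=
    fun θ hθ => (hd1 θ hθ).hasDerivWithinAt
  have h2 : ∀ θ ∈ Icc c d, HasDerivWithinAt f₁ (f₂ θ) (Icc c d) θ :=
    fun θ hθ => (hd2 θ hθ).hasDerivWithinAt
  have hL' : ∀ θ ∈ Icc c d, |f₂ θ| ≤ L * |f₁ θ| ^ 3 := by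
    intro θ hθ
    have := hL _ (mem_image_of_mem _ hθ)
    simp only [abs_mul, abs_inv, abs_pow] at this
    rwa [inv_mul_le_iff₀ (pow_pos (abs_pos.2 (hne θ hθ)) 3), mul_comm] at this
  -- `f'` is continuous, being differentiable, so without zeros it keeps one sign; the negative case
  -- passes to `-f`, which has the same curvature values.
  have hsign : (∀ θ ∈ Icc c d, 0 < f₁ θ) ∨ ∀ θ ∈ Icc c d, f₁ θ < 0 := by
    have hoc : (f₁ '' Icc c d).OrdConnected :=
      (isPreconnected_Icc.image _ hd2.continuousOn).ordConnected
    have h0 : (0 : ℝ) ∉ f₁ '' Icc c d := by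
      rintro ⟨θ, hθ, h⟩; exact hne θ hθ h
    by_contra! h
    obtain ⟨⟨θ, hθ, h⟩, θ', hθ', h'⟩ := h
    exact h0 (hoc.out (mem_image_of_mem _ hθ) (mem_image_of_mem _ hθ') ⟨h, h'⟩)
  rcases hsign with hp | hp
  · rw [abs_of_pos (hp s hs)]
    exact abs_sub_le_of_curvature_le h1 h2 hp
      (fun θ hθ => by simpa [abs_of_pos (hp θ hθ)] using hL' θ hθ) hs ht
  · rw [abs_of_neg (hp s hs)]
    have := abs_sub_le_of_curvature_le (L := L) (fun θ hθ => (h1 θ hθ).neg)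
      (fun θ hθ => (h2 θ hθ).neg) (fun θ hθ => by simpa using hp θ hθ)
      (fun θ hθ => by simpa [abs_of_neg (hp θ hθ)] using hL' θ hθ) hs ht
    convert this using 3
    · simp only [Pi.neg_apply]
      rw [← abs_neg]; congr 1; ring
    · simp only [Pi.neg_apply]; ring

end Inverse

/-- The least squares fit is at least as close to `f φ` as the sample mean is. -/
theorem IsLeastSquares.abs_sub_le {f : ℝ → ℝ} {c d : ℝ} (hf : ContinuousOn f (Icc c d)) {n : ℕ}
    {x : Fin n → ℝ} {s t : ℝ} (hs : IsLeastSquares f (Icc c d) x s) (ht : t ∈ Icc c d) :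
    |f t - f s| ≤ |sampleMean x - f t| := by
  have hoc : (f '' Icc c d).OrdConnected := (isPreconnected_Icc.image f hf).ordConnected
  by_cases hm : sampleMean x ∈ f '' Icc c d
  · obtain ⟨w, hw, hfw⟩ := hm
    have h := hs.2 w hw
    rw [hfw, sub_self, abs_zero] at h
    have h0 := abs_eq_zero.1 (le_antisymm h (abs_nonneg _))
    rw [sub_eq_zero.1 h0, abs_sub_comm]
  -- Outside the interval `f(Φ)`, either `S_n` lies beyond `f s` as seen from `f t`, or it lies
  -- beyond `f t`, and then minimality forces `f s = f t`.
  · have h1 := hs.2 t ht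
    rcases le_total (f s) (f t) with hle | hle
    · rcases le_total (sampleMean x) (f s) with h2 | h2
      · rw [abs_of_nonneg (by linarith), abs_of_nonpos (by linarith)]; linarith
      · have h3 : f t < sampleMean x := by
          by_contra! h3
          exact hm (hoc.out (mem_image_of_mem f hs.1) (mem_image_of_mem f ht) ⟨h2, h3⟩)
        rw [abs_of_nonneg (by linarith), abs_of_nonneg (by linarith)] at h1
        have : f s = f t := by linarith
        simp [this]
    · rcases le_total (f s) (sampleMean x) with h2 | h2
      · rw [abs_of_nonpos (by linarith), abs_of_nonneg (by linarith)]; linarith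
      · have h3 : sampleMean x < f t := by
          by_contra! h3
          exact hm (hoc.out (mem_image_of_mem f ht) (mem_image_of_mem f hs.1) ⟨h3, h2⟩)
        rw [abs_of_nonpos (by linarith), abs_of_nonpos (by linarith)] at h1
        have : f s = f t := by linarith
        simp [this]

end Metrology

namespace Metrology

/-! ### Hoeffding's inequality with a remainder -/

section ImprovedHoeffding

variable {Ω : Type*} [MeasurableSpace Ω] {μ : Measure Ω} [IsProbabilityMeasure μ]

/-- The second derivative of the cumulant generating function is the variance under the tilted
measure, which still lives on `[a, b]`; Popoviciu's inequality applies. -/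
theorem iteratedDeriv_two_cgf_le {Y : Ω → ℝ} {a b : ℝ} (hY : Measurable Y)
    (hb : ∀ᵐ ω ∂μ, Y ω ∈ Icc a b) (u : ℝ) :
    |iteratedDeriv 2 (cgf Y μ) u| ≤ ((b - a) / 2) ^ 2 := by
  have hi (u : ℝ) : Integrable (fun ω ↦ Real.exp (u * Y ω)) μ :=
    integrable_exp_mul_of_mem_Icc hY.aemeasurable hb
  have hu : u ∈ interior (integrableExpSet Y μ) := by simp [hi, integrableExpSet]
  rw [← variance_tilted_mul hu, abs_of_nonneg (variance_nonneg _ _)]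
  have := isProbabilityMeasure_tilted (hi u)
  exact variance_le_sq_of_bounded ((tilted_absolutelyContinuous μ (u * Y ·)) hb) hY.aemeasurable

/-- The derivative at `0` is the mean, here zero, so the bound on the second derivative integrates
from `0`. -/
theorem abs_deriv_cgf_le {Y : Ω → ℝ} {a b : ℝ} (hY : Measurable Y)
    (hb : ∀ᵐ ω ∂μ, Y ω ∈ Icc a b) (h0 : ∫ ω, Y ω ∂μ = 0) (u : ℝ) :
    |deriv (cgf Y μ) u| ≤ ((b - a) / 2) ^ 2 * |u| := by
  have hi (u : ℝ) : Integrable (fun ω ↦ Real.exp (u * Y ω)) μ :=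
    integrable_exp_mul_of_mem_Icc hY.aemeasurable hb
  have hu (u : ℝ) : u ∈ interior (integrableExpSet Y μ) := by simp [hi, integrableExpSet]
  have hd : ∀ x ∈ univ, DifferentiableAt ℝ (deriv (cgf Y μ)) x := fun x _ =>
    (analyticAt_cgf (hu x)).deriv.differentiableAt
  have h := Convex.norm_image_sub_le_of_norm_deriv_le hd
    (fun x _ => by
      have := iteratedDeriv_two_cgf_le hY hb x
      rwa [iteratedDeriv_succ, iteratedDeriv_one] at this) convex_univ (mem_univ 0) (mem_univ u)
  simpa [deriv_cgf_zero (hu 0), h0] using h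

/-- With `κ` the cumulant generating function of the sum `Z`, a second moment under the tilted law
gives `E Z² exp (uZ) = exp (κ u) (κ'' u + (κ' u)²)`. By independence `κ` is a sum, and each of the
three factors is bounded termwise. -/
theorem integral_sq_mul_exp_sum_le {n : ℕ} {Y : Fin n → Ω → ℝ} {a : Fin n → ℝ}
    (hY : ∀ i, Measurable (Y i)) (hind : iIndepFun Y μ)
    (hb : ∀ i, ∀ᵐ ω ∂μ, Y i ω ∈ Icc (a i) (a i + 1)) (h0 : ∀ i, ∫ ω, Y i ω ∂μ = 0) (u : ℝ) :
    Integrable (fun ω => (∑ i, Y i ω) ^ 2 * Real.exp (u * ∑ i, Y i ω)) μ ∧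
    ∫ ω, (∑ i, Y i ω) ^ 2 * Real.exp (u * ∑ i, Y i ω) ∂μ ≤
      Real.exp (n * u ^ 2 / 8) * (n / 4 + n ^ 2 * u ^ 2 / 16) := by
  have hiY (i : Fin n) (u : ℝ) : Integrable (fun ω ↦ Real.exp (u * Y i ω)) μ :=
    integrable_exp_mul_of_mem_Icc (hY i).aemeasurable (hb i)
  have huY (i : Fin n) (u : ℝ) : u ∈ interior (integrableExpSet (Y i) μ) := by
    simp [hiY i, integrableExpSet]
  set Z : Ω → ℝ := ∑ i, Y i with hZ
  have hZa : ∀ ω, ∑ i, Y i ω = Z ω := fun ω => by simp [hZ]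
  simp only [hZa]
  have hi (u : ℝ) : Integrable (fun ω ↦ Real.exp (u * Z ω)) μ :=
    hind.integrable_exp_mul_sum hY (fun i _ => hiY i u)
  have hu (u : ℝ) : u ∈ interior (integrableExpSet Z μ) := by simp [hi, integrableExpSet]
  have hcgf : cgf Z μ = fun u => ∑ i, cgf (Y i) μ u := by
    funext u
    exact hind.cgf_sum hY (fun i _ => hiY i u)
  have hmean : |deriv (cgf Z μ) u| ≤ n / 4 * |u| := by
    rw [hcgf, deriv_fun_sum (fun i _ => (analyticAt_cgf (huY i u)).differentiableAt)]
    calc _ ≤ ∑ i : Fin n, |deriv (cgf (Y i) μ) u| := Finset.abs_sum_le_sum_abs _ _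
      _ ≤ ∑ i : Fin n, (1 / 4 * |u|) := Finset.sum_le_sum fun i _ => by
        have := abs_deriv_cgf_le (hY i) (hb i) (h0 i) u
        calc _ ≤ _ := this
          _ = _ := by ring
      _ = n / 4 * |u| := by simp; ring
  have hvar : iteratedDeriv 2 (cgf Z μ) u ≤ n / 4 := by
    rw [hcgf, iteratedDeriv_fun_sum (fun i _ => (analyticAt_cgf (huY i u)).contDiffAt)]
    calc _ ≤ ∑ i : Fin n, (1 / 4 : ℝ) := Finset.sum_le_sum fun i _ => by
          have := le_of_abs_le (iteratedDeriv_two_cgf_le (hY i) (hb i) u)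
          calc _ ≤ _ := this
            _ = _ := by ring
      _ = n / 4 := by simp; ring
  have hmgf : mgf Z μ u ≤ Real.exp (n * u ^ 2 / 8) := by
    rw [hZ, hind.mgf_sum hY]
    calc _ ≤ ∏ i : Fin n, Real.exp (u ^ 2 / 8) :=
          Finset.prod_le_prod (fun i _ => mgf_nonneg) fun i _ => by
            have := (hasSubgaussianMGF_of_mem_Icc_of_integral_eq_zero (hY i).aemeasurable
              (hb i) (h0 i)).mgf_le u
            refine this.trans_eq ?_
            congr 1
            simp
            ring
      _ = _ := by
        rw [Finset.prod_const, ← Real.exp_nat_mul]; simp; ring_nf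
  have hint : Integrable (fun ω => Z ω ^ 2 * Real.exp (u * Z ω)) μ :=
    integrable_pow_mul_exp_of_mem_interior_integrableExpSet (hu u) 2
  refine ⟨hint, ?_⟩
  have hpos : 0 < mgf Z μ u := mgf_pos (hi u)
  have := isProbabilityMeasure_tilted (hi u)
  have h2 : ∫ ω, Z ω ^ 2 * Real.exp (u * Z ω) ∂μ =
      mgf Z μ u * (iteratedDeriv 2 (cgf Z μ) u + deriv (cgf Z μ) u ^ 2) := by
    rw [← variance_tilted_mul (hu u), ← integral_tilted_mul_self (hu u),
      variance_eq_sub (memLp_tilted_mul (hu u) 2), sub_add_cancel, integral_tilted_mul_eq_mgf,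
      ← integral_const_mul]
    refine integral_congr_ae (.of_forall fun ω => ?_)
    simp only [Pi.pow_apply, smul_eq_mul]
    field_simp
  rw [h2]
  have h3 : deriv (cgf Z μ) u ^ 2 ≤ n ^ 2 * u ^ 2 / 16 := by
    rw [← sq_abs]
    calc _ ≤ (n / 4 * |u|) ^ 2 := by gcongr
      _ = _ := by rw [mul_pow, sq_abs]; ring
  gcongr
  exact add_nonneg (by rw [← variance_tilted_mul (hu u)]; exact variance_nonneg _ _) (sq_nonneg _)

/-- A two-sided tail bound from the moments `E Z² exp (± u Z)`. -/
theorem measure_abs_sum_gt_le {n : ℕ} {Y : Fin n → Ω → ℝ} {a : Fin n → ℝ}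
    (hY : ∀ i, Measurable (Y i)) (hind : iIndepFun Y μ)
    (hb : ∀ i, ∀ᵐ ω ∂μ, Y i ω ∈ Icc (a i) (a i + 1)) (h0 : ∀ i, ∫ ω, Y i ω ∂μ = 0)
    (u : ℝ) {T : ℝ} (hT : 0 < T) :
    μ.real {ω | T < |∑ i, Y i ω|} ≤
      (n / 4 + n ^ 2 * u ^ 2 / 16) / T ^ 2 * (Real.exp (n * u ^ 2 / 8) / Real.cosh (u * T)) := by
  obtain ⟨hi1, hl1⟩ := integral_sq_mul_exp_sum_le hY hind hb h0 u
  obtain ⟨hi2, hl2⟩ := integral_sq_mul_exp_sum_le hY hind hb h0 (-u)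
  set g : Ω → ℝ := fun ω => (∑ i, Y i ω) ^ 2 * Real.exp (u * ∑ i, Y i ω) +
    (∑ i, Y i ω) ^ 2 * Real.exp (-u * ∑ i, Y i ω)
  have hg : ∫ ω, g ω ∂μ ≤ 2 * (Real.exp (n * u ^ 2 / 8) * (n / 4 + n ^ 2 * u ^ 2 / 16)) := by
    rw [integral_add hi1 hi2]
    rw [neg_sq] at hl2
    linarith
  have hg0 : 0 ≤ᵐ[μ] g := .of_forall fun ω => by positivity
  have hmk := mul_meas_ge_le_integral_of_nonneg hg0 (hi1.add hi2) (2 * T ^ 2 * Real.cosh (u * T))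
  -- `g = 2 Z² cosh (uZ)` is even and nondecreasing in `|Z|`, so one application of Markov's
  -- inequality covers both tails.
  have hsub : {ω | T < |∑ i, Y i ω|} ⊆ {ω | 2 * T ^ 2 * Real.cosh (u * T) ≤ g ω} := by
    intro ω hω
    simp only [mem_ofPred_eq] at hω ⊢
    set z := ∑ i, Y i ω with hz
    have hsq : T ^ 2 ≤ z ^ 2 := by rw [← sq_abs z]; gcongr
    have hcosh : Real.cosh (u * T) ≤ Real.cosh (u * z) := by
      rw [Real.cosh_le_cosh, abs_mul, abs_mul, abs_of_pos hT]
      gcongr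
    calc _ ≤ 2 * z ^ 2 * Real.cosh (u * z) := by gcongr
      _ = g ω := by simp only [g, ← hz, Real.cosh_eq]; ring_nf
  have hpos : 0 < 2 * T ^ 2 * Real.cosh (u * T) := by positivity
  calc _ ≤ _ := measureReal_mono hsub
    _ ≤ (2 * (Real.exp (n * u ^ 2 / 8) * (n / 4 + n ^ 2 * u ^ 2 / 16))) /
        (2 * T ^ 2 * Real.cosh (u * T)) := by
      rw [le_div_iff₀ hpos, mul_comm]
      exact hmk.trans hg
    _ = _ := by field_simp

/-- Writes the remainder as a fraction of Hoeffding's bound `2 exp (-l)`, so that the two numerical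
lemmas below only compare ratios with `1`. -/
theorem exp_neg_four_thirds (l : ℝ) : Real.exp (-(4 / 3 * (l + Real.log 2))) =
    2 * Real.exp (-l) * (1 / 4 * Real.exp (-((l + Real.log 2) / 3))) := by
  have h1 : Real.exp (-(4 / 3 * (l + Real.log 2))) =
      Real.exp (-l) * Real.exp (-Real.log 2) * Real.exp (-((l + Real.log 2) / 3)) := by
    rw [← Real.exp_add, ← Real.exp_add]; ring_nf
  rw [h1, Real.exp_neg (Real.log 2), Real.exp_log two_pos]
  ring

/-- Small `l`, where Chebyshev's inequality is used. The budget splits as `0.84 + 0.16`; by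
convexity `exp l ≤ 3.36 l` need only be checked at the end points, and `4 ^ (-1/3) ≤ 0.64`. -/
theorem exp_div_add_le_one {l : ℝ} (h1 : Real.log 2 ≤ l) (h2 : l ≤ 17 / 10) :
    Real.exp l / (4 * l) + 1 / 4 * Real.exp (-((l + Real.log 2) / 3)) ≤ 1 := by
  have hlog := Real.log_two_gt_d9
  have hl : 0 < l := by linarith
  have hx : Real.exp (-((l + Real.log 2) / 3)) ≤ 0.64 := by
    have h3 : Real.exp (-((l + Real.log 2) / 3)) ^ 3 ≤ 0.64 ^ 3 := by
      rw [← Real.exp_nat_mul]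
      calc _ ≤ Real.exp (-Real.log 2 + -Real.log 2) := Real.exp_le_exp.2 (by push_cast; linarith)
        _ = 1 / 4 := by
          rw [Real.exp_add, Real.exp_neg, Real.exp_log two_pos]; norm_num
        _ ≤ _ := by norm_num
    exact le_of_pow_le_pow_left₀ (by norm_num) (by norm_num) h3
  have hc : ConvexOn ℝ univ (fun y : ℝ => Real.exp y - 3.36 * y) :=
    convexOn_exp.sub ((concaveOn_id convex_univ).smul (by norm_num : (0 : ℝ) ≤ 3.36))
  have hm := hc.le_max_of_mem_Icc (mem_univ (Real.log 2)) (mem_univ (17 / 10)) ⟨h1, h2⟩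
  have he : Real.exp (17 / 10) ≤ 5.7 := by
    have h4 : Real.exp (17 / 10) ^ 10 ≤ 5.7 ^ 10 := by
      rw [← Real.exp_nat_mul]
      have : ((10 : ℕ) : ℝ) * (17 / 10) = (17 : ℕ) * 1 := by norm_num
      rw [this, Real.exp_nat_mul]
      calc _ ≤ (2.7182818286 : ℝ) ^ 17 := by gcongr; exact Real.exp_one_lt_d9.le
        _ ≤ _ := by norm_num
    exact le_of_pow_le_pow_left₀ (by norm_num) (by norm_num) h4
  have hm' : Real.exp l - 3.36 * l ≤ 0 := hm.trans (max_le (by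
    simp only [Real.exp_log two_pos]; linarith) (by linarith))
  have : Real.exp l / (4 * l) ≤ 0.84 := by
    rw [div_le_iff₀ (by positivity)]; linarith
  linarith

/-- Large `l`, with `v = 1/(2l)`. The first term is `1 - v + O(v³)`, since the quadratic terms
cancel, and stays below `1 - 0.5 v` for `v ≤ 5/17`. The second is at most `0.442 v`, from `x exp
(-x) ≤ 1/e` at `x = l/3`. -/
theorem mul_exp_add_le_one {l : ℝ} (h1 : 17 / 10 ≤ l) :
    (1 - 3 * (1 / (2 * l)) + 4 * (1 / (2 * l)) ^ 2) * Real.exp (2 * (1 / (2 * l))) +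
      1 / 4 * Real.exp (-((l + Real.log 2) / 3)) ≤ 1 := by
  have hl : 0 < l := by linarith
  have hx : Real.exp (-((l + Real.log 2) / 3)) ≤ 0.8 * Real.exp (-(l / 3)) := by
    have h3 : Real.exp (-(Real.log 2 / 3)) ≤ 0.8 := by
      refine le_of_pow_le_pow_left₀ (n := 3) (by norm_num) (by norm_num) ?_
      rw [← Real.exp_nat_mul]
      have : ((3 : ℕ) : ℝ) * -(Real.log 2 / 3) = -Real.log 2 := by push_cast; ring
      rw [this, Real.exp_neg, Real.exp_log two_pos]
      norm_num
    have : -((l + Real.log 2) / 3) = -(Real.log 2 / 3) + -(l / 3) := by ring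
    rw [this, Real.exp_add]
    gcongr
  have hy : Real.exp (-(l / 3)) ≤ 2.21 * (1 / (2 * l)) := by
    have h4 := Real.add_one_le_exp (l / 3 - 1)
    rw [sub_add_cancel, Real.exp_sub, le_div_iff₀ (Real.exp_pos 1)] at h4
    have h5 := Real.exp_one_gt_d9
    rw [Real.exp_neg, inv_le_comm₀ (Real.exp_pos _) (by positivity)]
    refine le_trans ?_ h4
    have : (2.21 * (1 / (2 * l)))⁻¹ = l / 3 * (6 / 2.21) := by field_simp; norm_num
    rw [this]
    gcongr
    norm_num at h5 ⊢
    linarith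
  set v := 1 / (2 * l) with hv
  have hv0 : 0 < v := by positivity
  have hv1 : v ≤ 5 / 17 := by
    rw [hv, div_le_div_iff₀ (by positivity) (by norm_num)]; linarith
  have he : Real.exp (2 * v) ≤ 1 + 2 * v + 2 * v ^ 2 + 4 / 3 * v ^ 3 + 5 / 6 * v ^ 4 := by
    have := Real.exp_bound' (x := 2 * v) (by positivity) (by linarith) (n := 4) (by norm_num)
    refine this.trans_eq ?_
    simp [Finset.sum_range_succ, Nat.factorial]
    ring
  have hq : 0 ≤ 1 - 3 * v + 4 * v ^ 2 := by nlinarith [sq_nonneg (v - 3 / 8)]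
  have hp : (1 - 3 * v + 4 * v ^ 2) * (1 + 2 * v + 2 * v ^ 2 + 4 / 3 * v ^ 3 + 5 / 6 * v ^ 4) ≤
      1 - 0.5 * v := by
    have h2 : v ^ 2 ≤ (5 / 17) ^ 2 := by gcongr
    have h3 : v ^ 3 ≤ (5 / 17) ^ 3 := by gcongr
    have h4 : v ^ 4 ≤ (5 / 17) ^ 4 := by gcongr
    have h5 : v ^ 5 ≤ (5 / 17) ^ 5 := by gcongr
    have : 0 ≤ v * (0.5 - (10 / 3 * v ^ 2 + 29 / 6 * v ^ 3 + 17 / 6 * v ^ 4 + 10 / 3 * v ^ 5)) :=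
      mul_nonneg hv0.le (by norm_num at h2 h3 h4 h5 ⊢; linarith)
    linarith
  have := mul_le_mul_of_nonneg_left he hq
  linarith

/-- **Hoeffding's inequality** with a remainder: the two-sided bound `2 exp (-l)` for `l ≥ log 2` can
be lowered by `exp (-4 (l + log 2) / 3)`. -/
theorem measure_abs_sum_gt_add_exp_le {n : ℕ} (hn : 1 ≤ n) {Y : Fin n → Ω → ℝ} {a : Fin n → ℝ}
    (hY : ∀ i, Measurable (Y i)) (hind : iIndepFun Y μ)
    (hb : ∀ i, ∀ᵐ ω ∂μ, Y i ω ∈ Icc (a i) (a i + 1)) (h0 : ∀ i, ∫ ω, Y i ω ∂μ = 0)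
    {l : ℝ} (hl : Real.log 2 ≤ l) :
    μ.real {ω | Real.sqrt (n * l / 2) < |∑ i, Y i ω|} + Real.exp (-(4 / 3 * (l + Real.log 2))) ≤
      2 * Real.exp (-l) := by
  have hl0 : 0 < l := (Real.log_pos one_lt_two).trans_le hl
  have hn0 : (0 : ℝ) < n := by exact_mod_cast hn
  have hT : 0 < Real.sqrt (n * l / 2) := by positivity
  have hT2 : Real.sqrt (n * l / 2) ^ 2 = n * l / 2 := Real.sq_sqrt (by positivity)
  rw [exp_neg_four_thirds]
  rcases le_total l (17 / 10) with h | h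
  -- At `u = 0` the tail bound is Chebyshev's inequality, with value `1/(2l)`.
  · have h1 := measure_abs_sum_gt_le hY hind hb h0 0 hT
    have h2 := exp_div_add_le_one hl h
    have h3 : μ.real {ω | Real.sqrt (n * l / 2) < |∑ i, Y i ω|} ≤
        2 * Real.exp (-l) * (Real.exp l / (4 * l)) := by
      refine h1.trans_eq ?_
      rw [hT2, Real.exp_neg]
      simp
      field_simp
    have := mul_le_mul_of_nonneg_left h2 (by positivity : 0 ≤ 2 * Real.exp (-l))
    linarith
  · set t := Real.sqrt (2 * l) with ht
    have ht0 : 0 < t := by positivity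
    have ht2 : t ^ 2 = 2 * l := Real.sq_sqrt (by positivity)
    set r := Real.sqrt n with hr
    have hr0 : 0 < r := by positivity
    have hr2 : r ^ 2 = n := Real.sq_sqrt hn0.le
    have hTt : Real.sqrt (n * l / 2) = r * t / 2 := by
      rw [Real.sqrt_eq_iff_mul_self_eq (by positivity) (by positivity)]
      linear_combination -(t ^ 2 / 4) * hr2 - n / 4 * ht2
    -- Hoeffding's exponent would be `k = t`. The factor `1 + k²` in front of `exp (k²/2 - kt)`
    -- moves the minimizer to about `t - 2/t`.
    set k := t - 2 / t with hk
    have hk2 : 1 + k ^ 2 = 2 * l * (1 - 3 * (1 / (2 * l)) + 4 * (1 / (2 * l)) ^ 2) := by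
      rw [hk, ← ht2]; field_simp; ring
    have hkt : k ^ 2 / 2 - k * t = 2 * (1 / (2 * l)) - l := by
      have : l = t ^ 2 / 2 := by linarith
      rw [hk, this]; field_simp; ring
    have h1 := measure_abs_sum_gt_le hY hind hb h0 (2 * k / r) hT
    have h2 := mul_exp_add_le_one h
    have h3 : μ.real {ω | Real.sqrt (n * l / 2) < |∑ i, Y i ω|} ≤ 2 * Real.exp (-l) *
        ((1 - 3 * (1 / (2 * l)) + 4 * (1 / (2 * l)) ^ 2) * Real.exp (2 * (1 / (2 * l)))) := by
      refine h1.trans ?_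
      have e1 : (n : ℝ) * (2 * k / r) ^ 2 / 8 = k ^ 2 / 2 := by
        rw [div_pow, hr2]; field_simp; ring
      have e2 : 2 * k / r * Real.sqrt (n * l / 2) = k * t := by rw [hTt]; field_simp
      have e3 : ((n : ℝ) / 4 + n ^ 2 * (2 * k / r) ^ 2 / 16) / Real.sqrt (n * l / 2) ^ 2 =
          1 - 3 * (1 / (2 * l)) + 4 * (1 / (2 * l)) ^ 2 := by
        rw [hT2, div_pow, hr2]
        have : ((n : ℝ) / 4 + n ^ 2 * ((2 * k) ^ 2 / n) / 16) / (n * l / 2) =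
          (1 + k ^ 2) / (2 * l) := by field_simp; ring
        rw [this, hk2]; field_simp
      rw [e1, e2, e3]
      have hq : 0 ≤ 1 - 3 * (1 / (2 * l)) + 4 * (1 / (2 * l)) ^ 2 := by
        nlinarith [sq_nonneg (1 / (2 * l) - 3 / 8)]
      have hcosh : Real.exp (k * t) / 2 ≤ Real.cosh (k * t) := by
        rw [Real.cosh_eq]
        linarith [Real.exp_pos (-(k * t))]
      calc _ ≤ (1 - 3 * (1 / (2 * l)) + 4 * (1 / (2 * l)) ^ 2) *
            (Real.exp (k ^ 2 / 2) / (Real.exp (k * t) / 2)) := by gcongr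
        _ = (1 - 3 * (1 / (2 * l)) + 4 * (1 / (2 * l)) ^ 2) *
            (2 * Real.exp (k ^ 2 / 2 - k * t)) := by rw [Real.exp_sub]; field_simp
        _ = _ := by rw [hkt, Real.exp_sub, Real.exp_neg l]; ring
    have := mul_le_mul_of_nonneg_left h2 (by positivity : 0 ≤ 2 * Real.exp (-l))
    linarith

end ImprovedHoeffding

end Metrology

namespace Metrology

/-! ### Bernstein's inequality -/

section Bernstein

/-- For `z ≤ 0` the quadratic Taylor polynomial already dominates. For `z ≥ 0`, `(1 - z/3)(exp z - 1
- z) ≤ z²/2`, proved by differentiating twice. -/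
theorem exp_le_one_add_add_of_le {l z : ℝ} (hl0 : 0 ≤ l) (hl3 : l < 3) (hz : z ≤ l) :
    Real.exp z ≤ 1 + z + z ^ 2 / (2 * (1 - l / 3)) := by
  have hpos : 0 < 1 - l / 3 := by linarith
  rcases le_total z 0 with h | h
  · have hq : Real.exp z ≤ 1 + z + z ^ 2 / 2 := by
      have hm : AntitoneOn (fun y : ℝ => 1 + y + y ^ 2 / 2 - Real.exp y) (Iic 0) := by
        have hd : ∀ y : ℝ, HasDerivAt (fun y : ℝ => 1 + y + y ^ 2 / 2 - Real.exp y)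
            (1 + y - Real.exp y) y := fun y => by
          have := (((hasDerivAt_id y).const_add 1).add (((hasDerivAt_id y).pow 2).div_const 2)).sub
            (Real.hasDerivAt_exp y)
          refine this.congr_deriv ?_
          simp
        refine antitoneOn_of_hasDerivWithinAt_nonpos (convex_Iic 0)
          (fun y _ => (hd y).continuousAt.continuousWithinAt)
          (fun y _ => (hd y).hasDerivWithinAt) fun y _ => ?_
        linarith [Real.add_one_le_exp y]
      have := hm h (mem_Iic.2 le_rfl) h
      simp at this
      linarith
    refine hq.trans ?_
    gcongr
    nlinarith
  · have hmono2 : MonotoneOn (fun y : ℝ => y - (1 - y / 3) * (Real.exp y - 1) +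
        (Real.exp y - 1 - y) / 3) (Ici 0) := by
      have hd : ∀ y : ℝ, HasDerivAt (fun y : ℝ => y - (1 - y / 3) * (Real.exp y - 1) +
          (Real.exp y - 1 - y) / 3) ((1 + (y - 1) * Real.exp y) / 3) y := fun y => by
        have he := Real.hasDerivAt_exp y
        have := ((hasDerivAt_id y).sub ((((hasDerivAt_id y).div_const 3).const_sub 1).mul
          (he.sub_const 1))).add (((he.sub_const 1).sub (hasDerivAt_id y)).div_const 3)
        refine this.congr_deriv ?_
        simp
        ring
      refine monotoneOn_of_hasDerivWithinAt_nonneg (convex_Ici 0)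
        (fun y _ => (hd y).continuousAt.continuousWithinAt)
        (fun y _ => (hd y).hasDerivWithinAt) fun y _ => ?_
      have h1 : (1 - y) * Real.exp y ≤ 1 := by
        have := Real.add_one_le_exp (-y)
        calc _ ≤ Real.exp (-y) * Real.exp y := by gcongr; linarith
          _ = 1 := by rw [← Real.exp_add]; simp
      have : 0 ≤ 1 + (y - 1) * Real.exp y := by linarith
      positivity
    have hmono : MonotoneOn (fun y : ℝ => y ^ 2 / 2 - (1 - y / 3) * (Real.exp y - 1 - y))
        (Ici 0) := by
      have hd : ∀ y : ℝ, HasDerivAt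
          (fun y : ℝ => y ^ 2 / 2 - (1 - y / 3) * (Real.exp y - 1 - y))
          (y - (1 - y / 3) * (Real.exp y - 1) + (Real.exp y - 1 - y) / 3) y := fun y => by
        have he := Real.hasDerivAt_exp y
        have := (((hasDerivAt_id y).pow 2).div_const 2).sub
          ((((hasDerivAt_id y).div_const 3).const_sub 1).mul
          ((he.sub_const 1).sub (hasDerivAt_id y)))
        refine this.congr_deriv ?_
        simp
        ring
      refine monotoneOn_of_hasDerivWithinAt_nonneg (convex_Ici 0)
        (fun y _ => (hd y).continuousAt.continuousWithinAt)
        (fun y _ => (hd y).hasDerivWithinAt) fun y hy => ?_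
      have hy' := interior_subset hy
      have := hmono2 (mem_Ici.2 le_rfl) hy' hy'
      simpa using this
    have h1 := hmono (mem_Ici.2 le_rfl) h h
    simp at h1
    have h2 : 0 ≤ Real.exp z - 1 - z := by linarith [Real.add_one_le_exp z]
    have h3 : (1 - l / 3) * (Real.exp z - 1 - z) ≤ z ^ 2 / 2 := by
      calc _ ≤ (1 - z / 3) * (Real.exp z - 1 - z) := by gcongr
        _ ≤ _ := h1
    have h4 : Real.exp z - 1 - z ≤ z ^ 2 / (2 * (1 - l / 3)) := by
      rw [le_div_iff₀ (by positivity)]; linarith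
    linarith

variable {Ω : Type*} [MeasurableSpace Ω] {μ : Measure Ω} [IsProbabilityMeasure μ]

theorem mgf_le_exp_of_variance {Y : Ω → ℝ} (hY : Measurable Y) (hb : ∀ᵐ ω ∂μ, Y ω ∈ Icc (-1) 1)
    (h0 : ∫ ω, Y ω ∂μ = 0) {l : ℝ} (hl0 : 0 ≤ l) (hl3 : l < 3) :
    mgf Y μ l ≤ Real.exp ((∫ ω, Y ω ^ 2 ∂μ) * (l ^ 2 / (2 * (1 - l / 3)))) := by
  have hi1 : Integrable Y μ := Integrable.of_mem_Icc _ _ hY.aemeasurable hb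
  have hi2 : Integrable (fun ω => Y ω ^ 2) μ :=
    Integrable.of_mem_Icc 0 1 (hY.pow_const 2).aemeasurable (by
      filter_upwards [hb] with ω hω
      exact ⟨sq_nonneg _, by nlinarith [hω.1, hω.2]⟩)
  calc mgf Y μ l ≤ ∫ ω, (1 + l * Y ω + Y ω ^ 2 * (l ^ 2 / (2 * (1 - l / 3)))) ∂μ := by
        refine integral_mono_ae (integrable_exp_mul_of_mem_Icc hY.aemeasurable hb)
          (((integrable_const 1).add (hi1.const_mul l)).add (hi2.mul_const _)) ?_
        filter_upwards [hb] with ω hω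
        refine (exp_le_one_add_add_of_le hl0 hl3 (z := l * Y ω)
          (by nlinarith [hω.2])).trans_eq ?_
        ring
    _ = 1 + (∫ ω, Y ω ^ 2 ∂μ) * (l ^ 2 / (2 * (1 - l / 3))) := by
        have hi3 : Integrable (fun ω => 1 + l * Y ω) μ :=
          (integrable_const 1).add (hi1.const_mul l)
        rw [integral_add hi3 (hi2.mul_const _),
          integral_add (integrable_const 1) (hi1.const_mul l), integral_const_mul, h0,
          integral_mul_const]
        simp
    _ ≤ _ := by linarith [Real.add_one_le_exp ((∫ ω, Y ω ^ 2 ∂μ) * (l ^ 2 / (2 * (1 - l / 3))))]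

/-- **Bernstein's inequality**, upper tail. -/
theorem measure_sum_ge_le_exp_of_variance {n : ℕ} {Y : Fin n → Ω → ℝ}
    (hY : ∀ i, Measurable (Y i)) (hind : iIndepFun Y μ)
    (hb : ∀ i, ∀ᵐ ω ∂μ, Y i ω ∈ Icc (-1) 1) (h0 : ∀ i, ∫ ω, Y i ω ∂μ = 0)
    {σ : ℝ} (hσ : 0 < σ) (hn : 1 ≤ n) (hv : ∀ i, ∫ ω, Y i ω ^ 2 ∂μ ≤ σ ^ 2) {t : ℝ} (ht : 0 ≤ t) :
    μ.real {ω | σ * Real.sqrt (2 * n * t) + t / 3 ≤ ∑ i, Y i ω} ≤ Real.exp (-t) := by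
  have hn0 : (0 : ℝ) < n := by exact_mod_cast hn
  set q := Real.sqrt (2 * n * t) with hq
  have hq0 : 0 ≤ q := Real.sqrt_nonneg _
  have hq2 : q ^ 2 = 2 * n * t := Real.sq_sqrt (by positivity)
  -- the minimizer of the sub-gamma exponent
  set s := q / (n * σ) with hs
  have hs0 : 0 ≤ s := by positivity
  set l := s / (1 + s / 3) with hl
  have hl0 : 0 ≤ l := by positivity
  have hl3 : l < 3 := by rw [hl, div_lt_iff₀ (by positivity)]; linarith
  have hl1 : 1 - l / 3 = 1 / (1 + s / 3) := by rw [hl]; field_simp; ring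
  have hiY (i : Fin n) : Integrable (fun ω ↦ Real.exp (l * Y i ω)) μ :=
    integrable_exp_mul_of_mem_Icc (hY i).aemeasurable (hb i)
  have hmgf : mgf (∑ i, Y i) μ l ≤ Real.exp (n * (σ ^ 2 * (l ^ 2 / (2 * (1 - l / 3))))) := by
    rw [hind.mgf_sum hY]
    calc _ ≤ ∏ i : Fin n, Real.exp (σ ^ 2 * (l ^ 2 / (2 * (1 - l / 3)))) :=
          Finset.prod_le_prod (fun i _ => mgf_nonneg) fun i _ =>
            (mgf_le_exp_of_variance (hY i) (hb i) (h0 i) hl0 hl3).trans (Real.exp_le_exp.2 (by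
              have : 0 < 1 - l / 3 := by linarith
              gcongr
              exact hv i))
      _ = _ := by rw [Finset.prod_const, ← Real.exp_nat_mul]; simp
  have hch := measure_ge_le_exp_mul_mgf (X := ∑ i, Y i) (μ := μ) (σ * q + t / 3) hl0
    (hind.integrable_exp_mul_sum hY (fun i _ => hiY i))
  have hset : {ω | σ * q + t / 3 ≤ (∑ i, Y i) ω} = {ω | σ * q + t / 3 ≤ ∑ i, Y i ω} := by
    ext ω; simp
  rw [hset] at hch
  refine hch.trans ?_
  calc _ ≤ Real.exp (-l * (σ * q + t / 3)) *
        Real.exp (n * (σ ^ 2 * (l ^ 2 / (2 * (1 - l / 3))))) := by gcongr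
    _ = Real.exp (-t) := by
      rw [← Real.exp_add]
      congr 1
      have h1 : q = n * σ * s := by rw [hs]; field_simp
      have h2 : t = n * σ ^ 2 * s ^ 2 / 2 := by
        rw [h1] at hq2
        have : 2 * (n : ℝ) * t = 2 * n * (n * σ ^ 2 * s ^ 2 / 2) := by rw [← hq2]; ring
        exact mul_left_cancel₀ (by positivity) this
      rw [hl1, h2, h1, hl]
      field_simp
      ring

/-- **Bernstein's inequality**, two-sided. -/
theorem measure_abs_sum_gt_le_exp_of_variance {n : ℕ} {Y : Fin n → Ω → ℝ}
    (hY : ∀ i, Measurable (Y i)) (hind : iIndepFun Y μ)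
    (hb : ∀ i, ∀ᵐ ω ∂μ, Y i ω ∈ Icc (-1) 1) (h0 : ∀ i, ∫ ω, Y i ω ∂μ = 0)
    {σ : ℝ} (hσ : 0 ≤ σ) (hn : 1 ≤ n) (hv : ∀ i, ∫ ω, Y i ω ^ 2 ∂μ ≤ σ ^ 2) {t : ℝ} (ht : 0 ≤ t) :
    μ.real {ω | σ * Real.sqrt (2 * n * t) + t / 3 < |∑ i, Y i ω|} ≤ 2 * Real.exp (-t) := by
  rcases hσ.eq_or_lt with rfl | hσ
  -- For `σ = 0` the optimal exponent would divide by zero, but then the variables vanish almost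
  -- surely.
  · have hz : ∀ i, Y i =ᵐ[μ] 0 := fun i => by
      have hi2 : Integrable (fun ω => Y i ω ^ 2) μ :=
        Integrable.of_mem_Icc 0 1 ((hY i).pow_const 2).aemeasurable (by
          filter_upwards [hb i] with ω hω
          exact ⟨sq_nonneg _, by nlinarith [hω.1, hω.2]⟩)
      have h := (integral_eq_zero_iff_of_nonneg (fun ω => sq_nonneg (Y i ω)) hi2).1
        (le_antisymm ((hv i).trans (by simp)) (integral_nonneg fun ω => sq_nonneg (Y i ω)))
      filter_upwards [h] with ω hω
      simpa using hω
    have hnull : μ {ω | 0 * Real.sqrt (2 * n * t) + t / 3 < |∑ i, Y i ω|} = 0 := by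
      refine measure_mono_null ?_ (ae_iff.1 (ae_all_iff.2 hz))
      intro ω hω h
      simp only [mem_ofPred_eq] at hω
      simp [h] at hω
      linarith
    rw [measureReal_def, hnull]
    simp [Real.exp_nonneg]
  · have h1 := measure_sum_ge_le_exp_of_variance hY hind hb h0 hσ hn hv ht
    have h2 := measure_sum_ge_le_exp_of_variance (Y := fun i ω => -Y i ω) (fun i => (hY i).neg)
      (hind.comp (fun _ y => -y) (fun _ => measurable_neg))
      (fun i => by
        filter_upwards [hb i] with ω hω
        exact ⟨by linarith [hω.2], by linarith [hω.1]⟩)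
      (fun i => by rw [integral_neg, h0 i, neg_zero]) hσ hn (by simpa using hv) ht
    have hsub : {ω | σ * Real.sqrt (2 * n * t) + t / 3 < |∑ i, Y i ω|} ⊆
        {ω | σ * Real.sqrt (2 * n * t) + t / 3 ≤ ∑ i, Y i ω} ∪
        {ω | σ * Real.sqrt (2 * n * t) + t / 3 ≤ ∑ i, -Y i ω} := by
      intro ω hω
      simp only [mem_ofPred_eq, mem_union, Finset.sum_neg_distrib] at hω ⊢
      rcases lt_abs.1 hω with h | h
      · exact Or.inl h.le
      · exact Or.inr h.le
    calc _ ≤ _ := measureReal_mono hsub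
      _ ≤ _ := measureReal_union_le _ _
      _ ≤ _ := by linarith

end Bernstein

end Metrology

namespace Metrology

/-! ### The sample variance as an average over permutations of sums over disjoint pairs -/

section PermutationAverage

theorem exists_perm_apply_eq_apply_eq {ι : Type*} [DecidableEq ι] {i j i' j' : ι} (h : i ≠ j)
    (h' : i' ≠ j') : ∃ τ : Equiv.Perm ι, τ i = i' ∧ τ j = j' := by
  refine ⟨Equiv.swap (Equiv.swap i i' j) j' * Equiv.swap i i', ?_, ?_⟩
  · have : i' ≠ Equiv.swap i i' j := by
      intro hc
      exact h ((Equiv.swap i i').injective (by rw [Equiv.swap_apply_left, ← hc]))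
    rw [Equiv.Perm.mul_apply, Equiv.swap_apply_left, Equiv.swap_apply_of_ne_of_ne this h']
  · rw [Equiv.Perm.mul_apply, Equiv.swap_apply_left]

/-- The average over all permutations of a function of two distinct positions. -/
theorem card_mul_sum_perm {n : ℕ} (g : Fin n → Fin n → ℝ) (hg : ∀ i, g i i = 0) {i j : Fin n}
    (h : i ≠ j) : (n * (n - 1) : ℝ) * ∑ π : Equiv.Perm (Fin n), g (π i) (π j) =
      (n.factorial : ℝ) * ∑ k, ∑ l, g k l := by
  set A : Fin n → Fin n → ℝ := fun k l => ∑ π : Equiv.Perm (Fin n), g (π k) (π l)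
  obtain ⟨c, hc⟩ : ∃ c, c = A i j := ⟨_, rfl⟩
  -- The symmetric group is doubly transitive, so reindexing by a permutation shows that all
  -- off-diagonal entries are equal.
  have hA : ∀ k l, A k l = c - if k = l then c else 0 := by
    intro k l
    split_ifs with hkl
    · simp [A, hkl, hg]
    · obtain ⟨τ, h1, h2⟩ := exists_perm_apply_eq_apply_eq h hkl
      rw [hc, sub_zero]
      exact Eq.trans (by simp [A, h1, h2])
        (Equiv.sum_comp (Equiv.mulRight τ) fun π => g (π i) (π j))
  have h1 : ∑ k, ∑ l, A k l = (n * (n - 1) : ℝ) * c := by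
    simp_rw [hA]
    simp [Finset.sum_sub_distrib]
    ring
  have h2 : ∑ k, ∑ l, A k l = (n.factorial : ℝ) * ∑ k, ∑ l, g k l := by
    have h3 : ∀ π : Equiv.Perm (Fin n), ∑ k, ∑ l, g (π k) (π l) = ∑ k, ∑ l, g k l := fun π => by
      rw [Equiv.sum_comp π (fun k => ∑ l, g k (π l))]
      exact Finset.sum_congr rfl fun k _ => Equiv.sum_comp π (g k)
    calc _ = ∑ k, ∑ π : Equiv.Perm (Fin n), ∑ l, g (π k) (π l) :=
          Finset.sum_congr rfl fun k _ => Finset.sum_comm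
      _ = ∑ π : Equiv.Perm (Fin n), ∑ k, ∑ l, g (π k) (π l) := Finset.sum_comm
      _ = _ := by
        simp_rw [h3]
        simp [Fintype.card_perm]
  rw [← h2, h1, hc]

theorem sampleVar_eq_sum_sum {n : ℕ} (hn : 2 ≤ n) (x : Fin n → ℝ) :
    (n * (n - 1) : ℝ) * sampleVar x = ∑ k, ∑ l, (x k - x l) ^ 2 / 2 := by
  have hn2 : (2 : ℝ) ≤ n := by exact_mod_cast hn
  have hn1 : (n : ℝ) - 1 ≠ 0 := by linarith
  have hn0 : (n : ℝ) ≠ 0 := by linarith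
  have h1 : ∑ k, ∑ l, (x k - x l) ^ 2 / 2 = n * ∑ k, x k ^ 2 - (∑ k, x k) ^ 2 := by
    have : ∀ k l, (x k - x l) ^ 2 / 2 = x k ^ 2 / 2 + x l ^ 2 / 2 - x k * x l := fun k l => by ring
    simp_rw [this, Finset.sum_sub_distrib, Finset.sum_add_distrib, ← Finset.mul_sum,
      ← Finset.sum_mul, ← Finset.sum_div]
    simp [← Finset.mul_sum]
    ring
  have h2 : (n : ℝ) * ∑ k, (x k - sampleMean x) ^ 2 = n * ∑ k, x k ^ 2 - (∑ k, x k) ^ 2 := by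
    have : ∀ k, (x k - sampleMean x) ^ 2 =
        x k ^ 2 - x k * (2 * sampleMean x) + sampleMean x ^ 2 := fun k => by ring
    simp_rw [this, Finset.sum_add_distrib, Finset.sum_sub_distrib, ← Finset.sum_mul]
    simp [sampleMean]
    field_simp
    ring
  rw [h1, ← h2, sampleVar]
  field_simp

/-- The sample variance is the average over all permutations of the data of the average of the
squared differences within `k` disjoint pairs. -/
theorem sampleVar_eq_sum_perm {n : ℕ} (hn : 2 ≤ n) {k : ℕ} (hk : 1 ≤ k) (p q : Fin k → Fin n)
    (hpq : ∀ j, p j ≠ q j) (x : Fin n → ℝ) :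
    k * sampleVar x = ∑ π : Equiv.Perm (Fin n), (n.factorial : ℝ)⁻¹ *
      ∑ j, (x (π (p j)) - x (π (q j))) ^ 2 / 2 := by
  have hn2 : (2 : ℝ) ≤ n := by exact_mod_cast hn
  have hn1 : (n : ℝ) - 1 ≠ 0 := by linarith
  have hn0 : (n : ℝ) ≠ 0 := by linarith
  have h1 : ∀ j, ∑ π : Equiv.Perm (Fin n), (x (π (p j)) - x (π (q j))) ^ 2 / 2 =
      (n.factorial : ℝ) * sampleVar x := fun j => by
    have h2 := card_mul_sum_perm (fun k l => (x k - x l) ^ 2 / 2) (by simp) (hpq j)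
    rw [← sampleVar_eq_sum_sum hn x] at h2
    refine mul_left_cancel₀ (mul_ne_zero hn0 hn1) (h2.trans ?_)
    ring
  rw [← Finset.mul_sum, Finset.sum_comm]
  simp_rw [h1]
  have := Nat.factorial_ne_zero n
  simp
  field_simp

end PermutationAverage

/-! ### Lower tail of the sample variance -/

section VarianceLowerTail

variable {Ω : Type*} [MeasurableSpace Ω] {μ : Measure Ω} [IsProbabilityMeasure μ]

/-- Functions of disjoint pairs of independent variables: the moment generating function of their
sum factorizes. -/
theorem mgf_sum_pairs {ι κ : Type*} [DecidableEq ι] {X : ι → Ω → ℝ} (hX : ∀ i, Measurable (X i))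
    (hind : iIndepFun X μ) {g : ℝ → ℝ → ℝ} (hg : Measurable fun z : ℝ × ℝ => g z.1 z.2)
    (p q : κ → ι) (hp : p.Injective) (hq : q.Injective) (hpq : ∀ j j', p j ≠ q j') (t : ℝ)
    (s : Finset κ) :
    mgf (fun ω => ∑ j ∈ s, g (X (p j) ω) (X (q j) ω)) μ t =
      ∏ j ∈ s, mgf (fun ω => g (X (p j) ω) (X (q j) ω)) μ t := by
  classical
  have hgm : ∀ j, Measurable fun ω => g (X (p j) ω) (X (q j) ω) := fun j =>
    hg.comp ((hX (p j)).prodMk (hX (q j)))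
  induction s using Finset.induction_on with
  | empty => simp [mgf]
  | insert j₀ s hj₀ ih =>
    rw [Finset.prod_insert hj₀, ← ih]
    set S : Finset ι := s.image p ∪ s.image q with hS
    set T : Finset ι := {p j₀, q j₀} with hT
    have hdisj : Disjoint T S := by
      rw [Finset.disjoint_left]
      intro i hi hi'
      simp only [hT, hS, Finset.mem_insert, Finset.mem_singleton, Finset.mem_union,
        Finset.mem_image] at hi hi'
      rcases hi with rfl | rfl <;> rcases hi' with ⟨j, hj, h⟩ | ⟨j, hj, h⟩
      · exact hj₀ (hp h ▸ hj)
      · exact hpq _ _ h.symm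
      · exact hpq _ _ h
      · exact hj₀ (hq h ▸ hj)
    have hI := hind.indepFun_finset T S hdisj hX
    -- Extension by `0` from `S` to all indices; the sum over `s` reads only coordinates in `S`, so
    -- the default is never used.
    let e : (S → ℝ) → ι → ℝ := fun y i => if h : i ∈ S then y ⟨i, h⟩ else 0
    have he : ∀ i, Measurable fun y : S → ℝ => e y i := fun i => by
      by_cases h : i ∈ S
      · simpa [e, h] using measurable_pi_apply (⟨i, h⟩ : S)
      · simp [e, h]
    have hφ : Measurable fun y : T → ℝ =>
        g (y ⟨p j₀, by simp [hT]⟩) (y ⟨q j₀, by simp [hT]⟩) := by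
      have := hg.comp ((measurable_pi_apply (X := fun _ : T => ℝ) ⟨p j₀, by simp [hT]⟩).prodMk
        (measurable_pi_apply (X := fun _ : T => ℝ) ⟨q j₀, by simp [hT]⟩))
      exact this
    have hψ : Measurable fun y : S → ℝ => ∑ j ∈ s, g (e y (p j)) (e y (q j)) :=
      Finset.measurable_fun_sum _ fun j _ => hg.comp ((he (p j)).prodMk (he (q j)))
    have hI' := hI.comp hφ hψ
    have h1 : ((fun y : S → ℝ => ∑ j ∈ s, g (e y (p j)) (e y (q j))) ∘ fun ω (i : S) => X i ω) =
        fun ω => ∑ j ∈ s, g (X (p j) ω) (X (q j) ω) := by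
      funext ω
      refine Finset.sum_congr rfl fun j hj => ?_
      have h2 : p j ∈ S := Finset.mem_union_left _ (Finset.mem_image_of_mem p hj)
      have h3 : q j ∈ S := Finset.mem_union_right _ (Finset.mem_image_of_mem q hj)
      simp [e, h2, h3]
    rw [h1] at hI'
    simp_rw [Finset.sum_insert hj₀]
    exact hI'.mgf_add ((hgm j₀).const_mul t).exp.aestronglyMeasurable
      (((Finset.measurable_fun_sum s fun j _ => hgm j).const_mul t).exp.aestronglyMeasurable)

/-- The variable `z = (X - Y)²/2` has mean `v` and lies in `[0, 1/2]`, so `z² ≤ z/2` and `exp (-sz)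
≤ 1 - sz + s²z²/2` becomes linear in `z`; no fourth moment is needed. -/
theorem mgf_neg_half_sq_sub_le {X Y : Ω → ℝ} (hX : Measurable X) (hY : Measurable Y)
    (hind : IndepFun X Y μ) {a : ℝ} (hXb : ∀ᵐ ω ∂μ, X ω ∈ Icc a (a + 1))
    (hYb : ∀ᵐ ω ∂μ, Y ω ∈ Icc a (a + 1)) (hX0 : ∫ ω, X ω ∂μ = 0) {v : ℝ}
    (hXv : ∫ ω, X ω ^ 2 ∂μ = v) (hYv : ∫ ω, Y ω ^ 2 ∂μ = v) {s : ℝ} (hs : 0 ≤ s) :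
    mgf (fun ω => (X ω - Y ω) ^ 2 / 2) μ (-s) ≤ Real.exp (-s * v + s ^ 2 * v / 4) := by
  have hXi : Integrable X μ := Integrable.of_mem_Icc _ _ hX.aemeasurable hXb
  have hYi : Integrable Y μ := Integrable.of_mem_Icc _ _ hY.aemeasurable hYb
  have hXL : MemLp X 2 μ := memLp_of_bounded hXb hX.aestronglyMeasurable 2
  have hYL : MemLp Y 2 μ := memLp_of_bounded hYb hY.aestronglyMeasurable 2
  have hX2 := hXL.integrable_sq
  have hY2 := hYL.integrable_sq
  have hXY : Integrable (fun ω => X ω * Y ω) μ := hind.integrable_mul hXi hYi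
  have hprod : ∫ ω, X ω * Y ω ∂μ = 0 := by
    rw [hind.integral_fun_mul_eq_mul_integral hX.aestronglyMeasurable hY.aestronglyMeasurable,
      hX0, zero_mul]
  have hm : Measurable fun ω => (X ω - Y ω) ^ 2 / 2 := ((hX.sub hY).pow_const 2).div_const 2
  have hb : ∀ᵐ ω ∂μ, (X ω - Y ω) ^ 2 / 2 ∈ Icc (0 : ℝ) (1 / 2) := by
    filter_upwards [hXb, hYb] with ω h1 h2
    refine ⟨by positivity, ?_⟩
    have : |X ω - Y ω| ≤ 1 := by
      rw [abs_le]; constructor <;> linarith [h1.1, h1.2, h2.1, h2.2]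
    have := (sq_le_one_iff_abs_le_one _).2 this
    linarith
  have hdi : Integrable (fun ω => (X ω - Y ω) ^ 2 / 2) μ :=
    Integrable.of_mem_Icc _ _ hm.aemeasurable hb
  have hd : ∫ ω, (X ω - Y ω) ^ 2 / 2 ∂μ = v := by
    have h1 : ∀ ω, (X ω - Y ω) ^ 2 / 2 = (X ω ^ 2 / 2 + Y ω ^ 2 / 2) - X ω * Y ω := fun ω => by ring
    have h2 : Integrable (fun ω => X ω ^ 2 / 2 + Y ω ^ 2 / 2) μ :=
      (hX2.div_const 2).add (hY2.div_const 2)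
    simp_rw [h1]
    rw [integral_sub h2 hXY, integral_add (hX2.div_const 2) (hY2.div_const 2), integral_div,
      integral_div, hXv, hYv, hprod]
    ring
  calc mgf (fun ω => (X ω - Y ω) ^ 2 / 2) μ (-s)
      ≤ ∫ ω, (1 + (-s + s ^ 2 / 4) * ((X ω - Y ω) ^ 2 / 2)) ∂μ := by
        refine integral_mono_ae (integrable_exp_mul_of_mem_Icc hm.aemeasurable hb)
          ((integrable_const 1).add (hdi.const_mul _)) ?_
        filter_upwards [hb] with ω hω
        set z := (X ω - Y ω) ^ 2 / 2
        have h1 := exp_le_one_add_add_of_le le_rfl (by norm_num : (0 : ℝ) < 3) (z := -s * z)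
          (by nlinarith [hω.1])
        rw [zero_div, sub_zero, mul_one] at h1
        have h2 : 0 ≤ s ^ 2 * (z * (1 / 2 - z)) :=
          mul_nonneg (sq_nonneg s) (mul_nonneg hω.1 (by linarith [hω.2]))
        change Real.exp (-s * z) ≤ 1 + (-s + s ^ 2 / 4) * z
        linarith
    _ = 1 + (-s * v + s ^ 2 * v / 4) := by
        rw [integral_add (integrable_const 1) (hdi.const_mul _), integral_const_mul, hd]
        simp
        ring
    _ ≤ _ := by linarith [Real.add_one_le_exp (-s * v + s ^ 2 * v / 4)]

/-- The lower tail of the sample variance. -/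
theorem measure_sampleVar_le {n : ℕ} {Y : Fin n → Ω → ℝ} (hY : ∀ i, Measurable (Y i))
    (hind : iIndepFun Y μ) {a : ℝ} (hb : ∀ i, ∀ᵐ ω ∂μ, Y i ω ∈ Icc a (a + 1))
    (h0 : ∀ i, ∫ ω, Y i ω ∂μ = 0) {v : ℝ} (hv0 : 0 < v) (hv : ∀ i, ∫ ω, Y i ω ^ 2 ∂μ = v)
    {k : ℕ} (hk : 1 ≤ k) (hkn : 2 * k ≤ n) {y : ℝ} (hy : 0 ≤ y) :
    μ.real {ω | sampleVar (fun i => Y i ω) ≤ v - y} ≤ Real.exp (-(k * y ^ 2 / v)) := by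
  have hk0 : (0 : ℝ) < k := by exact_mod_cast hk
  -- The minimizer of the Chernoff exponent `k (s² v/4 - s y)`.
  set s := 2 * y / v with hs
  have hs0 : 0 ≤ s := by positivity
  let p : Fin k → Fin n := fun j => ⟨2 * j, by lia⟩
  let q : Fin k → Fin n := fun j => ⟨2 * j + 1, by lia⟩
  have hp : p.Injective := fun i j h => by simp [p, Fin.ext_iff] at h; exact Fin.ext h
  have hq : q.Injective := fun i j h => by simp [q, Fin.ext_iff] at h; exact Fin.ext h
  have hpq : ∀ j j', p j ≠ q j' := fun j j' h => by simp [p, q] at h; lia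
  set D : Equiv.Perm (Fin n) → Ω → ℝ := fun π ω =>
    ∑ j, (Y (π (p j)) ω - Y (π (q j)) ω) ^ 2 / 2 with hD
  have hDm : ∀ π, Measurable (D π) := fun π => by simp only [hD]; fun_prop
  have hDi : ∀ π, Integrable (fun ω => Real.exp (-s * D π ω)) μ := fun π => by
    refine Integrable.of_mem_Icc 0 1 (((hDm π).const_mul _).exp).aemeasurable
      (.of_forall fun ω => ⟨Real.exp_nonneg _, Real.exp_le_one_iff.2 ?_⟩)
    have : 0 ≤ D π ω := Finset.sum_nonneg fun j _ => by positivity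
    nlinarith
  have hmgf : ∀ π, ∫ ω, Real.exp (-s * D π ω) ∂μ ≤
      Real.exp (k * (-s * v + s ^ 2 * v / 4)) := fun π => by
    have h1 := mgf_sum_pairs hY hind (g := fun x y => (x - y) ^ 2 / 2) (by fun_prop)
      (π ∘ p) (π ∘ q) (π.injective.comp hp) (π.injective.comp hq)
      (fun j j' h => hpq j j' (π.injective h)) (-s) Finset.univ
    calc _ = ∏ j : Fin k, _ := h1
      _ ≤ ∏ j : Fin k, Real.exp (-s * v + s ^ 2 * v / 4) :=
        Finset.prod_le_prod (fun j _ => mgf_nonneg) fun j _ =>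
          mgf_neg_half_sq_sub_le (hY _) (hY _)
            (hind.indepFun fun h => hpq j j (π.injective h)) (hb _) (hb _) (h0 _) (hv _) (hv _) hs0
      _ = _ := by rw [Finset.prod_const, ← Real.exp_nat_mul]; simp
  have hw : ∑ π : Equiv.Perm (Fin n), (n.factorial : ℝ)⁻¹ = 1 := by
    have := Nat.factorial_ne_zero n
    simp [Fintype.card_perm]
    field_simp
  -- Hoeffding's device for U-statistics: by convexity of `exp`, an average of dependent pair sums
  -- costs no more than a single sum of `k` independent pairs.
  have hjensen : ∀ ω, Real.exp (-s * (k * sampleVar fun i => Y i ω)) ≤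
      ∑ π : Equiv.Perm (Fin n), (n.factorial : ℝ)⁻¹ * Real.exp (-s * D π ω) := fun ω => by
    have h1 := convexOn_exp.map_sum_le (t := Finset.univ)
      (w := fun _ : Equiv.Perm (Fin n) => (n.factorial : ℝ)⁻¹) (p := fun π => -s * D π ω)
      (fun _ _ => by positivity) hw (fun _ _ => mem_univ _)
    simp only [smul_eq_mul] at h1
    refine le_trans (le_of_eq ?_) h1
    rw [sampleVar_eq_sum_perm (by lia) hk p q (fun j => hpq j j), Finset.mul_sum]
    congr 1
    exact Finset.sum_congr rfl fun π _ => by simp only [hD]; ring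
  have hi : Integrable (fun ω => ∑ π : Equiv.Perm (Fin n),
      (n.factorial : ℝ)⁻¹ * Real.exp (-s * D π ω)) μ :=
    integrable_finsetSum _ fun π _ => (hDi π).const_mul _
  have hint : ∫ ω, ∑ π : Equiv.Perm (Fin n), (n.factorial : ℝ)⁻¹ * Real.exp (-s * D π ω) ∂μ ≤
      Real.exp (k * (-s * v + s ^ 2 * v / 4)) := by
    rw [integral_finsetSum _ fun π _ => (hDi π).const_mul _]
    simp_rw [integral_const_mul]
    calc _ ≤ ∑ π : Equiv.Perm (Fin n), (n.factorial : ℝ)⁻¹ *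
          Real.exp (k * (-s * v + s ^ 2 * v / 4)) :=
          Finset.sum_le_sum fun π _ => by gcongr; exact hmgf π
      _ = _ := by rw [← Finset.sum_mul, hw, one_mul]
  have hmk := mul_meas_ge_le_integral_of_nonneg
    (.of_forall fun ω => Finset.sum_nonneg fun π _ => by positivity) hi
    (Real.exp (-s * (k * (v - y))))
  have hsub : {ω | sampleVar (fun i => Y i ω) ≤ v - y} ⊆ {ω | Real.exp (-s * (k * (v - y))) ≤
      ∑ π : Equiv.Perm (Fin n), (n.factorial : ℝ)⁻¹ * Real.exp (-s * D π ω)} := by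
    intro ω hω
    refine le_trans (Real.exp_le_exp.2 ?_) (hjensen ω)
    simp only [mem_ofPred_eq] at hω
    have : s * (k * sampleVar fun i => Y i ω) ≤ s * (k * (v - y)) := by gcongr
    linarith
  calc _ ≤ _ := measureReal_mono hsub
    _ ≤ Real.exp (k * (-s * v + s ^ 2 * v / 4)) / Real.exp (-s * (k * (v - y))) := by
      rw [le_div_iff₀ (Real.exp_pos _), mul_comm]
      exact hmk.trans hint
    _ = _ := by
      rw [← Real.exp_sub]
      congr 1
      rw [hs]
      field_simp
      ring

/-- The sample standard deviation rarely falls far below the standard deviation. -/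
theorem measure_sqrt_sampleVar_lt {n : ℕ} (hn : 2 ≤ n) {Y : Fin n → Ω → ℝ}
    (hY : ∀ i, Measurable (Y i)) (hind : iIndepFun Y μ) {a : ℝ}
    (hb : ∀ i, ∀ᵐ ω ∂μ, Y i ω ∈ Icc a (a + 1)) (h0 : ∀ i, ∫ ω, Y i ω ∂μ = 0) {σ : ℝ}
    (hv : ∀ i, ∫ ω, Y i ω ^ 2 ∂μ = σ ^ 2) {u : ℝ} (hu : 0 ≤ u) :
    μ.real {ω | Real.sqrt (sampleVar fun i => Y i ω) < σ - u} ≤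
      Real.exp (-((n - 1) * u ^ 2 / 2)) := by
  rcases le_or_gt σ u with h | h
  · have : {ω | Real.sqrt (sampleVar fun i => Y i ω) < σ - u} = ∅ := by
      ext ω
      simp only [mem_ofPred_eq, mem_empty_iff_false, iff_false, not_lt]
      linarith [Real.sqrt_nonneg (sampleVar fun i => Y i ω)]
    simp [this, Real.exp_nonneg]
  · have hσ : 0 < σ := hu.trans_lt h
    -- `σ² - y = (σ - u)²`, and `y ≥ σu` because `u < σ`. The integer quotient `n / 2` is at least
    -- `(n - 1)/2`, also for odd `n`.
    have h1 := measure_sampleVar_le hY hind hb h0 (pow_pos hσ 2) hv (k := n / 2) (by lia) (by lia)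
      (y := 2 * σ * u - u ^ 2) (by nlinarith)
    have hsub : {ω | Real.sqrt (sampleVar fun i => Y i ω) < σ - u} ⊆
        {ω | sampleVar (fun i => Y i ω) ≤ σ ^ 2 - (2 * σ * u - u ^ 2)} := by
      intro ω hω
      simp only [mem_ofPred_eq] at hω ⊢
      rw [Real.sqrt_lt' (by linarith)] at hω
      linarith
    refine (measureReal_mono hsub).trans (h1.trans (Real.exp_le_exp.2 (neg_le_neg ?_)))
    have h2 : ((n : ℝ) - 1) / 2 ≤ (n / 2 : ℕ) := by
      have : n ≤ 2 * (n / 2) + 1 := by lia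
      have : (n : ℝ) ≤ 2 * (n / 2 : ℕ) + 1 := by exact_mod_cast this
      linarith
    have h3 : u ^ 2 ≤ (2 * σ * u - u ^ 2) ^ 2 / σ ^ 2 := by
      rw [le_div_iff₀ (by positivity), ← mul_pow]
      have : u * σ ≤ 2 * σ * u - u ^ 2 := by nlinarith
      gcongr
    calc ((n : ℝ) - 1) * u ^ 2 / 2 = ((n - 1) / 2) * u ^ 2 := by ring
      _ ≤ (n / 2 : ℕ) * ((2 * σ * u - u ^ 2) ^ 2 / σ ^ 2) := by gcongr
      _ = _ := by ring

end VarianceLowerTail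

end Metrology

namespace Metrology

/-! ### Combining Hoeffding's and the empirical Bernstein bound -/

section Deviation

/-- The cost of replacing the true by the sample standard deviation fits into the constant `8/3`:
after squaring, the claim is `48 n (n - 1) ≤ (7n + 1)²`. -/
theorem sqrt_mul_sqrt_le_sub {n t : ℝ} (hn : 1 < n) (ht : 0 ≤ t) :
    Real.sqrt (2 * n * t) * Real.sqrt (8 * t / (3 * (n - 1))) ≤ 8 * n * t / (3 * (n - 1)) - t / 3 := by
  have hn1 : 0 < n - 1 := by linarith
  have he : 8 * n * t / (3 * (n - 1)) - t / 3 = t * (7 * n + 1) / (3 * (n - 1)) := by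
    field_simp; ring
  rw [he, ← Real.sqrt_mul (by positivity)]
  refine Real.sqrt_le_iff.2 ⟨by positivity, ?_⟩
  rw [div_pow, mul_div_assoc', div_le_div_iff₀ (by positivity) (by positivity)]
  have h1 : 0 ≤ t ^ 2 * (n - 1) * (n ^ 2 + 62 * n + 1) := by positivity
  linarith

variable {Ω : Type*} [MeasurableSpace Ω] {μ : Measure Ω} [IsProbabilityMeasure μ]

/-- Hoeffding's bound and the empirical Bernstein bound hold simultaneously, for centred data in an
interval of length one. -/
theorem measure_min_lt_abs_sum_le {n : ℕ} (hn : 2 ≤ n) {Y : Fin n → Ω → ℝ}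
    (hY : ∀ i, Measurable (Y i)) (hind : iIndepFun Y μ) {a : ℝ}
    (hb : ∀ i, ∀ᵐ ω ∂μ, Y i ω ∈ Icc a (a + 1)) (h0 : ∀ i, ∫ ω, Y i ω ∂μ = 0) {σ : ℝ} (hσ : 0 ≤ σ)
    (hv : ∀ i, ∫ ω, Y i ω ^ 2 ∂μ = σ ^ 2) {l t : ℝ} (hl : Real.log 2 ≤ l)
    (ht : t = l + Real.log 2) :
    μ.real {ω | min (Real.sqrt (n * l / 2)) (Real.sqrt (2 * n * t) *
      Real.sqrt (sampleVar fun i => Y i ω) + 8 * n * t / (3 * (n - 1))) < |∑ i, Y i ω|} ≤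
      2 * Real.exp (-l) := by
  have hn2 : (2 : ℝ) ≤ n := by exact_mod_cast hn
  have hn1 : 0 < (n : ℝ) - 1 := by linarith
  have hlog : 0 < Real.log 2 := Real.log_pos one_lt_two
  have ht0 : 0 ≤ t := by linarith
  -- Chosen so that `(n - 1) u²/2 = 4t/3`, the exponent of the remainder in the sharpened Hoeffding
  -- inequality.
  set u := Real.sqrt (8 * t / (3 * (n - 1))) with hu
  have hu2 : u ^ 2 = 8 * t / (3 * (n - 1)) := Real.sq_sqrt (by positivity)
  have hsd : μ.real {ω | Real.sqrt (sampleVar fun i => Y i ω) < σ - u} ≤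
      Real.exp (-(4 / 3 * (l + Real.log 2))) := by
    refine (measure_sqrt_sampleVar_lt hn hY hind hb h0 hv (Real.sqrt_nonneg _)).trans_eq ?_
    rw [hu2, ← ht]
    congr 2
    field_simp
    ring
  have hb' : ∀ i, ∀ᵐ ω ∂μ, Y i ω ∈ Icc (-1) 1 := fun i => by
    have h1 : a ≤ ∫ ω, Y i ω ∂μ ∧ ∫ ω, Y i ω ∂μ ≤ a + 1 := by
      have hi : Integrable (Y i) μ := Integrable.of_mem_Icc _ _ (hY i).aemeasurable (hb i)
      constructor
      · have := integral_mono_ae (integrable_const a) hi ((hb i).mono fun ω h => h.1)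
        simpa using this
      · have := integral_mono_ae hi (integrable_const (a + 1)) ((hb i).mono fun ω h => h.2)
        simpa using this
    rw [h0 i] at h1
    filter_upwards [hb i] with ω hω
    exact ⟨by linarith [hω.1, h1.2], by linarith [hω.2, h1.1]⟩
  set B := σ * Real.sqrt (2 * n * t) + t / 3 with hB
  have hsub : {ω | min (Real.sqrt (n * l / 2)) (Real.sqrt (2 * n * t) *
      Real.sqrt (sampleVar fun i => Y i ω) + 8 * n * t / (3 * (n - 1))) < |∑ i, Y i ω|} ⊆
      {ω | Real.sqrt (sampleVar fun i => Y i ω) < σ - u} ∪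
      {ω | min (Real.sqrt (n * l / 2)) B < |∑ i, Y i ω|} := by
    intro ω hω
    by_cases h : Real.sqrt (sampleVar fun i => Y i ω) < σ - u
    · exact Or.inl h
    · right
      simp only [mem_ofPred_eq] at hω ⊢
      refine lt_of_le_of_lt (min_le_min_left _ ?_) hω
      have h1 := sqrt_mul_sqrt_le_sub (n := n) (by linarith) ht0
      have h2 := mul_le_mul_of_nonneg_left (not_lt.1 h) (Real.sqrt_nonneg (2 * n * t))
      rw [← hu] at h1
      rw [hB]
      linarith
  have hmin : μ.real {ω | min (Real.sqrt (n * l / 2)) B < |∑ i, Y i ω|} +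
      Real.exp (-(4 / 3 * (l + Real.log 2))) ≤ 2 * Real.exp (-l) := by
    -- Both radii are now deterministic, so the minimum is one of them and no union bound over the
    -- two is needed. Bernstein's costs `2 exp (-t) = exp (-l)`, leaving room for the remainder,
    -- itself at most `exp (-l)/2`.
    rcases le_total B (Real.sqrt (n * l / 2)) with h | h
    · rw [min_eq_right h]
      have h1 := measure_abs_sum_gt_le_exp_of_variance hY hind hb' h0 hσ (by lia)
        (fun i => (hv i).le) ht0
      have h2 : Real.exp (-t) = Real.exp (-l) / 2 := by
        rw [ht, neg_add, Real.exp_add, Real.exp_neg (Real.log 2), Real.exp_log two_pos]; ring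
      have h3 : Real.exp (-(4 / 3 * (l + Real.log 2))) ≤ Real.exp (-t) :=
        Real.exp_le_exp.2 (by linarith)
      linarith [Real.exp_pos (-l)]
    · rw [min_eq_left h]
      exact measure_abs_sum_gt_add_exp_le (by lia) hY hind hb h0 hl
  calc _ ≤ _ := measureReal_mono hsub
    _ ≤ _ := measureReal_union_le _ _
    _ ≤ _ := by linarith

theorem sampleMean_affine {n : ℕ} (hn : 1 ≤ n) (x : Fin n → ℝ) (m : ℝ) {w : ℝ} (hw : w ≠ 0) :
    sampleMean x - m = w / n * ∑ i, (x i - m) / w := by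
  have : (n : ℝ) ≠ 0 := by positivity
  rw [← Finset.sum_div, Finset.sum_sub_distrib, sampleMean]
  simp
  field_simp

theorem sampleVar_affine {n : ℕ} (hn : 1 ≤ n) (x : Fin n → ℝ) (m : ℝ) {w : ℝ} (hw : w ≠ 0) :
    sampleVar x = w ^ 2 * sampleVar fun i => (x i - m) / w := by
  have hn0 : (n : ℝ) ≠ 0 := by positivity
  have h1 : ∀ i, (x i - m) / w - sampleMean (fun i => (x i - m) / w) =
      (x i - sampleMean x) / w := fun i => by
    have h2 : sampleMean (fun i => (x i - m) / w) = (sampleMean x - m) / w := by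
      rw [sampleMean_affine hn x m hw, sampleMean]
      field_simp
    rw [h2]; ring
  unfold sampleVar
  simp_rw [h1, div_pow, ← Finset.sum_div]
  field_simp

/-- Hoeffding's bound and the empirical Bernstein bound hold simultaneously. -/
theorem one_sub_le_measure_abs_sampleMean_sub_le {n : ℕ} (hn : 1 ≤ n) {X : Fin n → Ω → ℝ}
    (hX : ∀ i, Measurable (X i)) (hind : iIndepFun X μ) {a b : ℝ} (hab : a < b)
    (hb : ∀ i, ∀ᵐ ω ∂μ, X i ω ∈ Icc a b) {m v : ℝ} (hm : ∀ i, ∫ ω, X i ω ∂μ = m)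
    (hv : ∀ i, ∫ ω, (X i ω - m) ^ 2 ∂μ = v) {ε : ℝ} (hε : ε ∈ Ioo (0 : ℝ) 1) :
    1 - ε ≤ μ.real {ω |
      |sampleMean (fun i => X i ω) - m| ≤ Real.sqrt (2 / n * Vmax a b * Real.log (2 / ε)) ∧
      (n ≠ 1 → |sampleMean (fun i => X i ω) - m| ≤ bernsteinRadius a b (fun i => X i ω) ε)} := by
  set w := b - a with hw
  have hw0 : 0 < w := by linarith
  have hn0 : (0 : ℝ) < n := by exact_mod_cast hn
  set l := Real.log (2 / ε) with hl
  have hε0 := hε.1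
  have hl2 : Real.log 2 ≤ l := Real.log_le_log two_pos (by
    rw [le_div_iff₀ hε0]; linarith [hε.2])
  have hl0 : 0 < l := (Real.log_pos one_lt_two).trans_le hl2
  have hlexp : 2 * Real.exp (-l) = ε := by
    rw [hl, Real.exp_neg, Real.exp_log (by positivity)]; field_simp
  have ht : Real.log (4 / ε) = l + Real.log 2 := by
    rw [hl, ← Real.log_mul (by positivity) two_ne_zero]; congr 1; ring
  set Y : Fin n → Ω → ℝ := fun i ω => (X i ω - m) / w with hYdef
  have hYm : ∀ i, Measurable (Y i) := fun i => ((hX i).sub_const m).div_const w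
  have hYind : iIndepFun Y μ := hind.comp (fun _ x => (x - m) / w) fun _ => by fun_prop
  have hYb : ∀ i, ∀ᵐ ω ∂μ, Y i ω ∈ Icc ((a - m) / w) ((a - m) / w + 1) := fun i => by
    filter_upwards [hb i] with ω hω
    have h1 : (a - m) / w + 1 = (b - m) / w := by rw [div_add_one hw0.ne', hw]; congr 1; ring
    rw [h1]
    exact ⟨by simp only [hYdef]; gcongr; exact hω.1, by simp only [hYdef]; gcongr; exact hω.2⟩
  have hY0 : ∀ i, ∫ ω, Y i ω ∂μ = 0 := fun i => by
    have hi : Integrable (X i) μ := Integrable.of_mem_Icc _ _ (hX i).aemeasurable (hb i)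
    simp only [hYdef]
    rw [integral_div, integral_sub hi (integrable_const m), hm i]
    simp
  have hv0 : 0 ≤ v := by
    rw [← hv ⟨0, hn⟩]; exact integral_nonneg fun ω => sq_nonneg _
  have hYv : ∀ i, ∫ ω, Y i ω ^ 2 ∂μ = (Real.sqrt v / w) ^ 2 := fun i => by
    simp only [hYdef, div_pow]
    rw [integral_div, hv i, Real.sq_sqrt hv0]
  set E := {ω | |sampleMean (fun i => X i ω) - m| ≤ Real.sqrt (2 / n * Vmax a b * l) ∧
      (n ≠ 1 → |sampleMean (fun i => X i ω) - m| ≤ bernsteinRadius a b (fun i => X i ω) ε)} with hE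
  have habs : ∀ ω, |sampleMean (fun i => X i ω) - m| = w / n * |∑ i, Y i ω| := fun ω => by
    rw [sampleMean_affine hn _ m hw0.ne', abs_mul, abs_of_pos (by positivity)]
  have hhoef : Real.sqrt (2 / n * Vmax a b * l) = w / n * Real.sqrt (n * l / 2) := by
    rw [Real.sqrt_eq_iff_mul_self_eq (by unfold Vmax; positivity) (by positivity)]
    have := Real.mul_self_sqrt (show 0 ≤ n * l / 2 by positivity)
    rw [mul_mul_mul_comm, this, Vmax, ← hw]
    field_simp
    norm_num
  have hcompl : μ.real Eᶜ ≤ ε := by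
    rw [← hlexp]
    by_cases hn1 : n = 1
    · have h1 := measure_abs_sum_gt_add_exp_le hn hYm hYind hYb hY0 hl2
      have hsub : Eᶜ ⊆ {ω | Real.sqrt (n * l / 2) < |∑ i, Y i ω|} := by
        intro ω hω
        by_contra h
        refine hω ⟨?_, fun h2 => absurd hn1 h2⟩
        simp only [mem_ofPred_eq, not_lt] at h
        rw [habs, hhoef]
        gcongr
      linarith [measureReal_mono hsub (μ := μ), Real.exp_pos (-(4 / 3 * (l + Real.log 2)))]
    · have hn2 : 2 ≤ n := by lia
      have hn2' : (2 : ℝ) ≤ n := by exact_mod_cast hn2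
      have hn1' : 0 < (n : ℝ) - 1 := by linarith
      have h1 := measure_min_lt_abs_sum_le hn2 hYm hYind hYb hY0 (by positivity) hYv hl2 ht
      refine (measureReal_mono ?_).trans h1
      intro ω hω
      by_contra h
      simp only [mem_ofPred_eq, not_lt, le_min_iff] at h
      refine hω ⟨?_, fun _ => ?_⟩
      · rw [habs, hhoef]
        gcongr
        exact h.1
      · rw [habs]
        have ht0 : 0 ≤ Real.log (4 / ε) := by
          rw [ht]; linarith [Real.log_pos one_lt_two]
        refine (mul_le_mul_of_nonneg_left h.2 (by positivity)).trans_eq ?_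
        have h2 : Real.sqrt (2 / n * sampleVar (fun i => X i ω) * Real.log (4 / ε)) =
            w / n * (Real.sqrt (2 * n * Real.log (4 / ε)) *
              Real.sqrt (sampleVar fun i => Y i ω)) := by
          rw [sampleVar_affine hn _ m hw0.ne']
          have h3 : 2 / n * (w ^ 2 * sampleVar fun i => (X i ω - m) / w) * Real.log (4 / ε) =
              (w / n) ^ 2 * ((2 * n * Real.log (4 / ε)) * sampleVar fun i => Y i ω) := by
            simp only [hYdef]; field_simp
          rw [h3, Real.sqrt_mul (sq_nonneg _), Real.sqrt_sq (by positivity),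
            Real.sqrt_mul (by positivity)]
        rw [bernsteinRadius, h2, ← hw]
        field_simp
  have huniv : (1 : ℝ) ≤ μ.real E + μ.real Eᶜ := by
    have h := measureReal_union_le (μ := μ) E Eᶜ
    rwa [union_compl_self, probReal_univ] at h
  linarith

end Deviation

/-! ### Born's rule: support and total mass of the outcome law -/

section Quantum

theorem IsOutcomeLaw.ae_mem {H : Type*} [NormedAddCommGroup H] [InnerProductSpace ℂ H]
    [CompleteSpace H] {ρ : H →L[ℂ] H} {M : POVM H} {P : Measure ℝ} (hP : IsOutcomeLaw ρ M P)
    {s : Set ℝ} (hs : MeasurableSet s) (hM : M.effect sᶜ = 0) : ∀ᵐ y ∂P, y ∈ s := by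
  rw [ae_iff]
  have := hP sᶜ hs.compl
  rw [hM, mul_zero] at this
  exact this.trans (by simp [opTrace])

theorem IsOutcomeLaw.isProbabilityMeasure {H : Type*} [NormedAddCommGroup H]
    [InnerProductSpace ℂ H] [CompleteSpace H] {ρ : H →L[ℂ] H} {M : POVM H} {P : Measure ℝ}
    (hP : IsOutcomeLaw ρ M P) (hρ : IsDensityOperator ρ) : IsProbabilityMeasure P :=
  ⟨by rw [hP univ MeasurableSet.univ, M.effect_univ, mul_one, hρ.2]; simp⟩

end Quantum

end Metrology

open Metrology in
theorem theorem1
    {H : Type*} [NormedAddCommGroup H] [InnerProductSpace ℂ H] [CompleteSpace H]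
    -- the parameter range `Φ`, the states `ρ_φ` and the measurement, with outcomes in `[a, b]`
    (φmin φmax : ℝ) (hΦ : φmin < φmax)
    (ρ : ℝ → H →L[ℂ] H) (hρ : ∀ θ ∈ Set.Icc φmin φmax, IsDensityOperator (ρ θ))
    (M : POVM H) (a b : ℝ) (hab : M.effect (Set.Icc a b)ᶜ = 0)
    -- the distribution of a single outcome, and its expectation `f`
    (P : ℝ → Measure ℝ) (hP : ∀ θ ∈ Set.Icc φmin φmax, IsOutcomeLaw (ρ θ) M (P θ))
    (f : ℝ → ℝ) (hf : ∀ θ ∈ Set.Icc φmin φmax, f θ = ∫ y, y ∂(P θ))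
    -- `f` is injective and twice differentiable, `f'` has no zero, the maximum `L` exists
    (hinj : Set.InjOn f (Set.Icc φmin φmax))
    (hd1 : DifferentiableOn ℝ f (Set.Icc φmin φmax))
    (hd2 : DifferentiableOn ℝ (derivWithin f (Set.Icc φmin φmax)) (Set.Icc φmin φmax))
    (hne : ∀ θ ∈ Set.Icc φmin φmax, derivWithin f (Set.Icc φmin φmax) θ ≠ 0)
    (L : ℝ) (hL : IsGreatest (curvatureValues f (Set.Icc φmin φmax)) L)
    (n : ℕ) (hn : 1 ≤ n) (ε : ℝ) (hε : ε ∈ Set.Ioo (0 : ℝ) 1)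
    (φ : ℝ) (hφ : φ ∈ Set.Icc φmin φmax)
    -- the data: `n` independent outcomes with the distribution of the true parameter `φ`
    {Ω : Type*} [MeasurableSpace Ω] (μ : Measure Ω) [IsProbabilityMeasure μ]
    (X : Fin n → Ω → ℝ) (hX : ∀ i, Measurable (X i)) (hind : iIndepFun X μ)
    (hlaw : ∀ i, μ.map (X i) = P φ) :
    1 - ε ≤ μ.real {ω | |lsEstimate f (Set.Icc φmin φmax) (fun i => X i ω) - φ|
      ≤ delta f (Set.Icc φmin φmax) a b L (fun i => X i ω) ε} := by
  have hmem : ∀ θ ∈ Icc φmin φmax, ∀ᵐ y ∂(P θ), y ∈ Icc a b :=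
    fun θ hθ => (hP θ hθ).ae_mem measurableSet_Icc hab
  have hprob : ∀ θ ∈ Icc φmin φmax, IsProbabilityMeasure (P θ) :=
    fun θ hθ => (hP θ hθ).isProbabilityMeasure (hρ θ hθ)
  -- Needed to rescale to unit length; otherwise all outcomes would equal `a` and `f` would be
  -- constant, against injectivity on a nondegenerate interval.
  have hlt : a < b := by
    by_contra! hba
    have hconst : ∀ θ ∈ Icc φmin φmax, f θ = a := fun θ hθ => by
      have := hprob θ hθ
      rw [hf θ hθ, integral_congr_ae (g := fun _ => a)
        ((hmem θ hθ).mono fun y hy => le_antisymm (hy.2.trans hba) hy.1)]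
      simp
    have hl := left_mem_Icc.2 hΦ.le
    have hr := right_mem_Icc.2 hΦ.le
    exact hΦ.ne (hinj hl hr ((hconst _ hl).trans (hconst _ hr).symm))
  have hXb : ∀ i, ∀ᵐ ω ∂μ, X i ω ∈ Icc a b := fun i =>
    ae_of_ae_map (hX i).aemeasurable (by rw [hlaw i]; exact hmem φ hφ)
  have hXm : ∀ i, ∫ ω, X i ω ∂μ = f φ := fun i => by
    rw [hf φ hφ, ← hlaw i, integral_map (hX i).aemeasurable (by fun_prop)]
  have hXv : ∀ i, ∫ ω, (X i ω - f φ) ^ 2 ∂μ = ∫ y, (y - f φ) ^ 2 ∂(P φ) := fun i => by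
    rw [← hlaw i, integral_map (hX i).aemeasurable (by fun_prop)]
  refine (one_sub_le_measure_abs_sampleMean_sub_le hn hX hind hlt hXb hXm hXv hε).trans
    (measureReal_mono ?_)
  rintro ω ⟨h1, h2⟩
  set x : Fin n → ℝ := fun i => X i ω with hx
  have hls := isLeastSquares_lsEstimate hΦ.le hd1.continuousOn hinj x
  -- Makes the error bar nondecreasing in the radius `r`.
  have hL0 : 0 ≤ L := by
    obtain ⟨θ, -, h⟩ := hL.1
    rw [← h]
    exact abs_nonneg _
  have hS := hls.abs_sub_le hd1.continuousOn hφ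
  have hT := abs_sub_le_of_mem_curvatureValues_le hd1 hd2 hne hL.2 hls.1 hφ
  set s := lsEstimate f (Icc φmin φmax) x with hs
  have key : ∀ r, |sampleMean x - f φ| ≤ r →
      |s - φ| ≤ 1 / |derivWithin f (Icc φmin φmax) s| * r + L / 2 * r ^ 2 := fun r hr => by
    rw [abs_sub_comm]
    refine hT.trans ?_
    rw [← sq_abs (f φ - f s)]
    have := hS.trans hr
    gcongr
  have hlog : 0 ≤ Real.log (2 / ε) :=
    Real.log_nonneg (by rw [le_div_iff₀ hε.1]; linarith [hε.2])
  have hδ1 : |s - φ| ≤ delta1 f (Icc φmin φmax) a b L x ε := by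
    refine (key _ h1).trans_eq ?_
    rw [delta1, ← hs, Real.sq_sqrt (by unfold Vmax; positivity)]
    ring
  change |s - φ| ≤ _
  rw [delta]
  split_ifs with hn1
  · exact hδ1
  · exact le_min hδ1 (key _ (h2 hn1))
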